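/- Let $d\ge 1$ and let $P$ be a set of $n$ points picked independently and uniformly at random from the unit cube $[0,1]^d$. A set $L$ of hyperplanes in $\mathbb{R}^d$ separates $P$ if for every two distinct points $p,q\in P$ some hyperplane of $L$ meets the interior of the segment $pq$ and contains neither $p$ nor $q$; let $S_{n,d}$ be the smallest number of hyperplanes in a set that separates $P$. (i) $S_{n,d}=\Omega\bigl(n^{2/(d+1)}\log\log n/\log n\bigr)$ with high probability: for every $d\ge 1$ and every $\gamma>0$ there are $c>0$ and $n_0$, depending only on $d$ and $\gamma$, such that for all $n\ge n_0$ $$\Pr\Bigl[S_{n,d}\ \ge\ c\,n^{2/(d+1)}\,\frac{\log\log n}{\log n}\Bigr]\ \ge\ 1-n^{-\gamma}.$$ (ii) There is an absolute constant $C>0$ such that for all $d\ge 1$ and all $n\ge 0$ $$\mathbb{E}[S_{n,d}]\ \le\ C\,d\,n^{2/(d+1)}.$$ -/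

import Mathlib

open MeasureTheory
open scoped ENNReal

/-- A hyperplane of `ℝ^d`, as a set of points: the solutions of one nontrivial linear equation
`⟨a, x⟩ = b`. -/
def IsHyperplane {d : ℕ} (H : Set (Fin d → ℝ)) : Prop :=
  ∃ (a : Fin d → ℝ) (b : ℝ), a ≠ 0 ∧ H = {x | a ⬝ᵥ x = b}

/-- The points `p` and `q` lie (strictly) on different sides of the hyperplane `H`: it meets the
interior of the segment `pq` and contains neither `p` nor `q`. -/
def OnDifferentSides {d : ℕ} (H : Set (Fin d → ℝ)) (p q : Fin d → ℝ) : Prop :=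
  (H ∩ openSegment ℝ p q).Nonempty ∧ p ∉ H ∧ q ∉ H

/-- `L` is a set of hyperplanes that separates the point set `P`: every two distinct points of `P`
are on different sides of some member of `L`. -/
def IsSeparatingSet {d : ℕ} (L : Set (Set (Fin d → ℝ))) (P : Set (Fin d → ℝ)) : Prop :=
  (∀ H ∈ L, IsHyperplane H) ∧
    ∀ p ∈ P, ∀ q ∈ P, p ≠ q → ∃ H ∈ L, OnDifferentSides H p q

/-- The separability of `P`: the least number of hyperplanes in a set of hyperplanes that
separates `P` (`⊤` if no finite set does). -/
noncomputable def separability {d : ℕ} (P : Set (Fin d → ℝ)) : ℕ∞ :=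
  ⨅ (L : Set (Set (Fin d → ℝ))) (_ : IsSeparatingSet L P), L.encard

/-- The uniform distribution on the unit cube `[0,1]^d`. -/
noncomputable def uniformCube (d : ℕ) : Measure (Fin d → ℝ) :=
  volume.restrict (Set.Icc 0 1)

instance (d : ℕ) : IsProbabilityMeasure (uniformCube d) :=
  ⟨by simp [uniformCube, Real.volume_Icc_pi]⟩

/-- The joint law of `n` independent uniform random points `x 0, …, x (n - 1)` of `[0,1]^d`. -/
noncomputable def uniformPoints (d n : ℕ) : Measure (Fin n → Fin d → ℝ) :=
  Measure.pi fun _ => uniformCube d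

instance (d n : ℕ) : IsProbabilityMeasure (uniformPoints d n) := by
  unfold uniformPoints; infer_instance

/-- The separability of the random point set `{x 0, …, x (n - 1)}`, as an extended nonnegative
real. -/
noncomputable def sepNumber {d n : ℕ} (x : Fin n → Fin d → ℝ) : ℝ≥0∞ :=
  ((separability (Set.range x) : ℕ∞) : ℝ≥0∞)

/-! Both bounds come from cutting the cube into `N ^ d` equal cells. Cell assignments of the `n`
points are uniform over all maps from `Fin n` to cells, so probabilities become counts
(`uniformPoints_gridCell_le`).

Upper bound: the `d * (N - 1)` inner grid walls separate points in different cells, and one extra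
hyperplane is spent on each pair sharing a cell. At most `n ^ 2 / N ^ d` ordered pairs share a cell
on average, and `N` about `n ^ (2 / (d + 1))` balances the two costs.

Lower bound: with `N` of the same order, a cell holding two points (a collision) must be met by a
hyperplane of every separating set. With high probability there are more than `N / 16` collisions
(`card_few_collisions_le`), while no hyperplane meets `t` of them, for `t` of order `log n / log log
n`. Indeed every hyperplane meeting the grid stays inside one of polynomially many slabs of `O(N ^
(d - 1))` cells (`cellsMeeting_subset_gridSlab`). A slab has `O(1)` expected collisions, so it has
`t` of them with probability at most `β ^ t / t!` (`card_collisions_inter_ge_mul_le`), small enough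
for a union bound over slabs. Hence at least `N / (16 * t)` hyperplanes are needed
(`card_collisions_le`). -/

/-! ### The grid and the law of the cell assignment -/

/-- The index of the interval, among `N` equal parts of `[0,1]`, that contains `y`. -/
noncomputable def gridIndex (N : ℕ) [NeZero N] (y : ℝ) : Fin N :=
  ⟨min ⌊(N : ℝ) * y⌋₊ (N - 1), by have := NeZero.pos N; omega⟩

/-- The cell of the `N × ⋯ × N` grid on `[0,1]^d` that contains `p`. -/
noncomputable def gridCell (N : ℕ) [NeZero N] {d : ℕ} (p : Fin d → ℝ) : Fin d → Fin N :=
  fun k => gridIndex N (p k)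

theorem gridIndex_bounds {N : ℕ} [NeZero N] {y : ℝ} (hy : y ∈ Set.Icc (0 : ℝ) 1) :
    ((gridIndex N y : ℕ) : ℝ) ≤ N * y ∧ (N : ℝ) * y ≤ (gridIndex N y : ℕ) + 1 := by
  have hN := NeZero.pos N
  have h0 : (0 : ℝ) ≤ N * y := by have := hy.1; positivity
  have h1 : (N : ℝ) * y ≤ N := by have := hy.2; nlinarith [(Nat.cast_pos (α := ℝ)).2 hN]
  simp only [gridIndex]
  refine ⟨(Nat.cast_le.2 (min_le_left _ _)).trans (Nat.floor_le h0), ?_⟩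
  rcases min_choice ⌊(N : ℝ) * y⌋₊ (N - 1) with h | h
  · rw [h]; exact (Nat.lt_floor_add_one _).le
  · rw [h]; push_cast [Nat.cast_sub (show 1 ≤ N from hN)]; linarith

theorem gridIndex_eq {N : ℕ} [NeZero N] {y : ℝ} {q : Fin N} (h1 : (q : ℝ) ≤ N * y)
    (h2 : (N : ℝ) * y < q + 1) : gridIndex N y = q := by
  have h : ⌊(N : ℝ) * y⌋₊ = q :=
    (Nat.floor_eq_iff ((Nat.cast_nonneg _).trans h1)).2 ⟨h1, h2⟩
  ext
  simp only [gridIndex, h]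
  have := q.2
  omega

theorem volume_gridIndex_preimage {N : ℕ} [NeZero N] (q : Fin N) :
    volume {y : ℝ | y ∈ Set.Icc (0 : ℝ) 1 ∧ gridIndex N y = q} = (N : ℝ≥0∞)⁻¹ := by
  have hN : (0 : ℝ) < N := Nat.cast_pos.2 (NeZero.pos N)
  have hv : ENNReal.ofReal (((q : ℝ) + 1) / N - q / N) = (N : ℝ≥0∞)⁻¹ := by
    rw [← sub_div, add_sub_cancel_left, one_div, ENNReal.ofReal_inv_of_pos hN,
      ENNReal.ofReal_natCast]
  apply le_antisymm
  · rw [← hv, ← Real.volume_Icc]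
    apply measure_mono
    rintro y ⟨hy, rfl⟩
    have := gridIndex_bounds (N := N) hy
    rw [Set.mem_Icc, div_le_iff₀ hN, le_div_iff₀ hN]
    constructor <;> nlinarith
  · rw [← hv, ← Real.volume_Ioo]
    apply measure_mono
    rintro y ⟨h1, h2⟩
    rw [div_lt_iff₀ hN] at h1
    rw [lt_div_iff₀ hN] at h2
    have hq : (q : ℝ) + 1 ≤ N := by exact_mod_cast q.2
    have hq0 : (0 : ℝ) ≤ q := Nat.cast_nonneg _
    exact ⟨⟨by nlinarith, by nlinarith⟩, gridIndex_eq (by nlinarith) (by nlinarith)⟩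

theorem uniformCube_gridCell_preimage {N : ℕ} [NeZero N] {d : ℕ} (q : Fin d → Fin N) :
    uniformCube d {p | gridCell N p = q} = ((N : ℝ≥0∞) ^ d)⁻¹ := by
  rw [uniformCube, Measure.restrict_apply' measurableSet_Icc]
  have : {p : Fin d → ℝ | gridCell N p = q} ∩ Set.Icc 0 1 =
      Set.univ.pi fun k => {y : ℝ | y ∈ Set.Icc (0 : ℝ) 1 ∧ gridIndex N y = q k} := by
    ext p
    simp only [gridCell, funext_iff, Set.mem_inter_iff, Set.mem_ofPred_eq, Set.mem_Icc,
      Pi.le_def, Set.mem_univ_pi, Pi.zero_apply, Pi.one_apply]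
    exact ⟨fun h k => ⟨⟨h.2.1 k, h.2.2 k⟩, h.1 k⟩,
      fun h => ⟨fun k => (h k).2, fun k => (h k).1.1, fun k => (h k).1.2⟩⟩
  rw [this, volume_pi_pi]
  simp_rw [volume_gridIndex_preimage]
  simp [ENNReal.inv_pow]

/-- Each assignment is a product event of probability `N ^ (-d * n)`. Only subadditivity is used, so
the event need not be shown measurable. -/
theorem uniformPoints_gridCell_le {N : ℕ} [NeZero N] {d n : ℕ}
    (E : Finset (Fin n → Fin d → Fin N)) :
    uniformPoints d n {x | (fun i => gridCell N (x i)) ∈ E} ≤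
      E.card * (((N : ℝ≥0∞) ^ d) ^ n)⁻¹ := by
  have : {x : Fin n → Fin d → ℝ | (fun i => gridCell N (x i)) ∈ E} ⊆
      ⋃ f ∈ E, Set.univ.pi fun i => {p | gridCell N p = f i} := by
    intro x hx
    simp only [Set.mem_iUnion]
    exact ⟨_, hx, fun i _ => rfl⟩
  refine (measure_mono this).trans ((measure_biUnion_finset_le _ _).trans ?_)
  simp [uniformPoints, Measure.pi_pi, uniformCube_gridCell_preimage, ENNReal.inv_pow]

theorem card_eq_eval {ι κ : Type*} [Fintype ι] [DecidableEq ι] [Fintype κ] [DecidableEq κ]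
    {i j : ι} (hij : i ≠ j) :
    (Finset.univ.filter fun f : ι → κ => f i = f j).card ≤
      Fintype.card κ ^ (Fintype.card ι - 1) := by
  have := Fintype.card_le_of_injective
    (fun (f : {f : ι → κ // f i = f j}) (l : {l : ι // l ≠ i}) => f.1 l) (by
      intro f g h
      ext l
      have hl : ∀ l, l ≠ i → f.1 l = g.1 l := fun l hl => congrFun h ⟨l, hl⟩
      by_cases e : l = i
      · rw [e, f.2, g.2, hl j hij.symm]
      · exact hl l e)
  rw [Fintype.card_subtype] at this
  simpa using this

theorem uniformPoints_same_cell_le {N : ℕ} [NeZero N] {d n : ℕ} {i j : Fin n} (hij : i ≠ j) :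
    uniformPoints d n {x | gridCell N (x i) = gridCell N (x j)} ≤ ((N : ℝ≥0∞) ^ d)⁻¹ := by
  have h := uniformPoints_gridCell_le
    (Finset.univ.filter fun f : Fin n → Fin d → Fin N => f i = f j)
  simp only [Finset.mem_filter, Finset.mem_univ, true_and] at h
  refine h.trans ?_
  have hc := card_eq_eval (κ := Fin d → Fin N) hij
  simp only [Fintype.card_pi, Fintype.card_fin, Finset.prod_const, Finset.card_univ] at hc
  have hM0 : ((N : ℝ≥0∞) ^ d) ≠ 0 := by simp [NeZero.ne N]
  have hMt : ((N : ℝ≥0∞) ^ d) ≠ ⊤ := by simp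
  calc _ ≤ ((N : ℝ≥0∞) ^ d) ^ (n - 1) * (((N : ℝ≥0∞) ^ d) ^ n)⁻¹ := by
        gcongr; exact_mod_cast hc
    _ = _ := by
      obtain ⟨m, rfl⟩ : ∃ m, n = m + 1 := ⟨n - 1, by have := i.2; omega⟩
      rw [Nat.add_sub_cancel, pow_succ, ENNReal.mul_inv (by simp) (by simp [hMt]), ← mul_assoc,
        ENNReal.mul_inv_cancel (by simp [NeZero.ne N]) (by finiteness), one_mul]

/-- Coinciding points share a cell of every grid, however fine, and for `d ≥ 1` that probability
tends to zero. -/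
theorem ae_uniformPoints_injective {d : ℕ} (hd : 1 ≤ d) (n : ℕ) :
    ∀ᵐ x ∂(uniformPoints d n), Function.Injective x := by
  have : ∀ i j : Fin n, i ≠ j → ∀ᵐ x ∂(uniformPoints d n), x i ≠ x j := by
    intro i j hij
    rw [ae_iff]
    simp only [ne_eq, not_not]
    refine le_antisymm (ge_of_tendsto' (x := Filter.atTop)
      (f := fun m : ℕ => ((m + 1 : ℕ) : ℝ≥0∞)⁻¹) ?_ fun m => ?_) zero_le
    · exact (ENNReal.tendsto_inv_nat_nhds_zero).comp (Filter.tendsto_add_atTop_nat 1)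
    · refine (measure_mono ?_).trans ((uniformPoints_same_cell_le (N := m + 1) (d := d) hij).trans ?_)
      · intro x (hx : x i = x j)
        simp [hx]
      · rw [ENNReal.inv_le_inv]
        exact le_self_pow₀ (by norm_num) (by omega)
  have h : ∀ᵐ x ∂(uniformPoints d n), ∀ i j, i ≠ j → x i ≠ x j := by
    rw [ae_all_iff]; intro i
    rw [ae_all_iff]; intro j
    by_cases hij : i = j
    · simp [hij]
    · filter_upwards [this i j hij] with x hx _ using hx
  filter_upwards [h] with x hx i j hij
  by_contra hne
  exact hx i j hne hij

theorem ae_uniformPoints_of_ae {d n : ℕ} {s : (Fin d → ℝ) → Prop}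
    (h : ∀ᵐ p ∂(uniformCube d), s p) : ∀ᵐ x ∂(uniformPoints d n), ∀ i, s (x i) := by
  rw [ae_all_iff]
  intro i
  exact (Measure.quasiMeasurePreserving_eval (μ := fun _ : Fin n => uniformCube d) i).ae h

theorem ae_uniformPoints_mem_Icc (d n : ℕ) :
    ∀ᵐ x ∂(uniformPoints d n), ∀ i k, x i k ∈ Set.Icc (0 : ℝ) 1 := by
  apply ae_uniformPoints_of_ae (s := fun p => ∀ k, p k ∈ Set.Icc (0 : ℝ) 1)
  filter_upwards [ae_restrict_mem (measurableSet_Icc (a := (0 : Fin d → ℝ)) (b := 1))] with p hp k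
  exact ⟨hp.1 k, hp.2 k⟩

theorem ae_uniformPoints_coord_ne (d n : ℕ) (b : ℝ) :
    ∀ᵐ x ∂(uniformPoints d n), ∀ i k, x i k ≠ b := by
  apply ae_uniformPoints_of_ae (s := fun p => ∀ k, p k ≠ b)
  apply ae_restrict_of_ae
  rw [ae_all_iff]
  intro k
  have : ∀ᵐ y : ℝ, y ≠ b := by simp [ae_iff]
  exact (Measure.quasiMeasurePreserving_eval (μ := fun _ : Fin d => (volume : Measure ℝ)) k).ae this

/-! ### Separation by hyperplanes -/

theorem onDifferentSides_iff {d : ℕ} {a : Fin d → ℝ} {b : ℝ} {p q : Fin d → ℝ} :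
    OnDifferentSides {x | a ⬝ᵥ x = b} p q ↔ (a ⬝ᵥ p - b) * (a ⬝ᵥ q - b) < 0 := by
  constructor
  · rintro ⟨⟨y, hy, s, t, hs, ht, hst, rfl⟩, hp, hq⟩
    simp only [Set.mem_ofPred_eq, dotProduct_add, dotProduct_smul, smul_eq_mul] at hy hp hq
    have hp' : a ⬝ᵥ p - b ≠ 0 := sub_ne_zero.2 hp
    have h : s * (a ⬝ᵥ p - b) + t * (a ⬝ᵥ q - b) = 0 := by
      linear_combination hy - b * hst
    have h2 : t * ((a ⬝ᵥ p - b) * (a ⬝ᵥ q - b)) = -(s * (a ⬝ᵥ p - b) ^ 2) := by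
      linear_combination (a ⬝ᵥ p - b) * h
    have h3 : 0 < s * (a ⬝ᵥ p - b) ^ 2 := by positivity
    by_contra hcon
    have := mul_nonneg ht.le (not_lt.1 hcon)
    linarith
  · intro h
    have key : ∀ u v : ℝ, u * v < 0 → ∃ s t : ℝ, 0 < s ∧ 0 < t ∧ s + t = 1 ∧ s * u + t * v = 0 := by
      intro u v huv
      have hne : u - v ≠ 0 := by
        intro h0
        rw [sub_eq_zero.1 h0] at huv
        exact (mul_self_nonneg v).not_gt huv
      refine ⟨-v / (u - v), u / (u - v), ?_, ?_, by field_simp; ring, by field_simp; ring⟩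
      · rw [show -v / (u - v) = (-(u * v) + v ^ 2) / (u - v) ^ 2 by field_simp; ring]
        have : 0 < (u - v) ^ 2 := by positivity
        have : 0 < -(u * v) + v ^ 2 := by nlinarith [sq_nonneg v]
        positivity
      · rw [show u / (u - v) = (-(u * v) + u ^ 2) / (u - v) ^ 2 by field_simp; ring]
        have : 0 < (u - v) ^ 2 := by positivity
        have : 0 < -(u * v) + u ^ 2 := by nlinarith [sq_nonneg u]
        positivity
    obtain ⟨s, t, hs, ht, hst, h0⟩ := key _ _ h
    refine ⟨⟨s • p + t • q, ?_, s, t, hs, ht, hst, rfl⟩, ?_, ?_⟩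
    · simp only [Set.mem_ofPred_eq, dotProduct_add, dotProduct_smul, smul_eq_mul]
      linear_combination h0 + b * hst
    · intro hp
      simp only [Set.mem_ofPred_eq] at hp
      simp [hp] at h
    · intro hq
      simp only [Set.mem_ofPred_eq] at hq
      simp [hq] at h

/-- The perpendicular bisector works. -/
theorem exists_onDifferentSides {d : ℕ} {p q : Fin d → ℝ} (h : p ≠ q) :
    ∃ H, IsHyperplane H ∧ OnDifferentSides H p q := by
  refine ⟨{x | (p - q) ⬝ᵥ x = (p - q) ⬝ᵥ ((1 / 2 : ℝ) • (p + q))},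
    ⟨_, _, sub_ne_zero.2 h, rfl⟩, ?_⟩
  rw [onDifferentSides_iff, ← dotProduct_sub, ← dotProduct_sub,
    show p - (1 / 2 : ℝ) • (p + q) = (1 / 2 : ℝ) • (p - q) by module,
    show q - (1 / 2 : ℝ) • (p + q) = -(1 / 2 : ℝ) • (p - q) by module]
  simp only [dotProduct_smul, smul_eq_mul]
  have h0 : (p - q) ⬝ᵥ (p - q) ≠ 0 := fun h0 => h (sub_eq_zero.1 (dotProduct_self_eq_zero.1 h0))
  have : 0 < ((p - q) ⬝ᵥ (p - q)) ^ 2 := by positivity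
  linarith

theorem separability_le_encard {d : ℕ} {L : Set (Set (Fin d → ℝ))} {P : Set (Fin d → ℝ)}
    (h : IsSeparatingSet L P) : separability P ≤ L.encard :=
  iInf_le_of_le L (iInf_le _ h)

theorem exists_finset_of_separability_le {d k : ℕ} {P : Set (Fin d → ℝ)}
    (h : separability P ≤ k) :
    ∃ L : Finset (Set (Fin d → ℝ)), IsSeparatingSet (L : Set (Set (Fin d → ℝ))) P ∧
      L.card ≤ k := by
  have h1 : separability P < ((k + 1 : ℕ) : ℕ∞) :=
    h.trans_lt (by exact_mod_cast Nat.lt_succ_self k)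
  simp only [separability, iInf_lt_iff] at h1
  obtain ⟨L, hL, hlt⟩ := h1
  obtain ⟨L, rfl⟩ := (Set.finite_of_encard_le_coe hlt.le).exists_finset_coe
  rw [Set.encard_coe_eq_coe_finsetCard] at hlt
  exact ⟨L, hL, Nat.lt_succ_iff.1 (by exact_mod_cast hlt)⟩

theorem sepNumber_le_card {d n : ℕ} {x : Fin n → Fin d → ℝ} (L : Finset (Set (Fin d → ℝ)))
    (h : IsSeparatingSet (L : Set (Set (Fin d → ℝ))) (Set.range x)) : sepNumber x ≤ L.card := by
  have := separability_le_encard h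
  rw [Set.encard_coe_eq_coe_finsetCard] at this
  unfold sepNumber
  exact_mod_cast ENat.toENNReal_le.2 this

/-! ### The upper bound in expectation -/

theorem exists_grid_onDifferentSides {N : ℕ} [NeZero N] {d : ℕ} {p q : Fin d → ℝ}
    (hp : ∀ k, p k ∈ Set.Icc (0 : ℝ) 1) (hq : ∀ k, q k ∈ Set.Icc (0 : ℝ) 1)
    (hp' : ∀ (c : Fin (N - 1)) k, p k ≠ ((c : ℕ) + 1 : ℝ) / N)
    (hq' : ∀ (c : Fin (N - 1)) k, q k ≠ ((c : ℕ) + 1 : ℝ) / N) (h : gridCell N p ≠ gridCell N q) :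
    ∃ (k : Fin d) (c : Fin (N - 1)),
      OnDifferentSides {x | Pi.single k (1 : ℝ) ⬝ᵥ x = ((c : ℕ) + 1 : ℝ) / N} p q := by
  have hN : (0 : ℝ) < N := Nat.cast_pos.2 (NeZero.pos N)
  have key : ∀ u v : ℝ, u ∈ Set.Icc (0 : ℝ) 1 → v ∈ Set.Icc (0 : ℝ) 1 →
      gridIndex N u < gridIndex N v → ∃ c : Fin (N - 1), u ≤ ((c : ℕ) + 1 : ℝ) / N ∧
        ((c : ℕ) + 1 : ℝ) / N ≤ v := by
    intro u v hu hv huv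
    have hlt : (gridIndex N u : ℕ) < gridIndex N v := huv
    have hv2 := (gridIndex N v).2
    refine ⟨⟨gridIndex N u, by omega⟩, ?_, ?_⟩
    · rw [le_div_iff₀ hN, mul_comm]
      exact (gridIndex_bounds hu).2
    · rw [div_le_iff₀ hN, mul_comm v]
      refine le_trans ?_ (gridIndex_bounds hv).1
      exact_mod_cast hlt
  obtain ⟨k, hk⟩ := Function.ne_iff.1 h
  rcases lt_or_gt_of_ne hk with hlt | hlt
  · obtain ⟨c, h1, h2⟩ := key _ _ (hp k) (hq k) hlt
    refine ⟨k, c, onDifferentSides_iff.2 ?_⟩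
    simp only [single_one_dotProduct]
    exact mul_neg_of_neg_of_pos (sub_neg.2 (lt_of_le_of_ne h1 (hp' c k)))
      (sub_pos.2 (lt_of_le_of_ne h2 (hq' c k).symm))
  · obtain ⟨c, h1, h2⟩ := key _ _ (hq k) (hp k) hlt
    refine ⟨k, c, onDifferentSides_iff.2 ?_⟩
    simp only [single_one_dotProduct]
    exact mul_neg_of_pos_of_neg (sub_pos.2 (lt_of_le_of_ne h2 (hp' c k).symm))
      (sub_neg.2 (lt_of_le_of_ne h1 (hq' c k)))

theorem sepNumber_le_grid {N : ℕ} [NeZero N] {d n : ℕ} {x : Fin n → Fin d → ℝ}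
    (hx : ∀ i k, x i k ∈ Set.Icc (0 : ℝ) 1)
    (hx' : ∀ (c : Fin (N - 1)) i k, x i k ≠ ((c : ℕ) + 1 : ℝ) / N) :
    sepNumber x ≤ ((d * (N - 1) + (Finset.univ.filter fun ij : Fin n × Fin n =>
      ij.1 ≠ ij.2 ∧ gridCell N (x ij.1) = gridCell N (x ij.2)).card : ℕ) : ℝ≥0∞) := by
  classical
  set S := Finset.univ.filter fun ij : Fin n × Fin n =>
      ij.1 ≠ ij.2 ∧ gridCell N (x ij.1) = gridCell N (x ij.2) with hS
  have hB : ∀ ij : Fin n × Fin n, ∃ H, (x ij.1 ≠ x ij.2 →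
      IsHyperplane H ∧ OnDifferentSides H (x ij.1) (x ij.2)) := by
    intro ij
    by_cases h : x ij.1 = x ij.2
    · exact ⟨∅, fun h' => (h' h).elim⟩
    · obtain ⟨H, hH⟩ := exists_onDifferentSides h
      exact ⟨H, fun _ => hH⟩
  choose B hB using hB
  let G : Finset (Set (Fin d → ℝ)) := Finset.univ.image fun kc : Fin d × Fin (N - 1) =>
    {y | Pi.single kc.1 (1 : ℝ) ⬝ᵥ y = ((kc.2 : ℕ) + 1 : ℝ) / N}
  let T := S.filter fun ij => x ij.1 ≠ x ij.2
  refine (sepNumber_le_card (G ∪ T.image B) ⟨?_, ?_⟩).trans ?_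
  · intro H hH
    simp only [Finset.coe_union, Set.mem_union, Finset.mem_coe, G, Finset.mem_image,
      Finset.mem_univ, true_and, T, Finset.mem_filter] at hH
    rcases hH with ⟨kc, rfl⟩ | ⟨ij, ⟨-, hij⟩, rfl⟩
    · exact ⟨_, _, by simp, rfl⟩
    · exact (hB ij hij).1
  · rintro _ ⟨i, rfl⟩ _ ⟨j, rfl⟩ hij
    by_cases hc : gridCell N (x i) = gridCell N (x j)
    · refine ⟨B (i, j), ?_, (hB (i, j) hij).2⟩
      simp only [Finset.coe_union, Set.mem_union, Finset.mem_coe]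
      refine Or.inr (Finset.mem_image_of_mem _ ?_)
      simp only [T, hS, Finset.mem_filter, Finset.mem_univ, true_and]
      exact ⟨⟨fun h => hij (by rw [h]), hc⟩, hij⟩
    · obtain ⟨k, c, h⟩ := exists_grid_onDifferentSides (hx i) (hx j) (fun c k => hx' c i k)
        (fun c k => hx' c j k) hc
      refine ⟨_, ?_, h⟩
      simp only [Finset.coe_union, Set.mem_union, Finset.mem_coe]
      exact Or.inl (Finset.mem_image.2 ⟨(k, c), Finset.mem_univ _, rfl⟩)
  · refine Nat.cast_le.2 ((Finset.card_union_le _ _).trans (add_le_add ?_ ?_))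
    · exact Finset.card_image_le.trans (by simp)
    · exact Finset.card_image_le.trans (Finset.card_filter_le _ _)

theorem lintegral_sepNumber_le_grid (N : ℕ) [NeZero N] (d n : ℕ) :
    ∫⁻ x, sepNumber x ∂(uniformPoints d n) ≤
      ((d * (N - 1) : ℕ) : ℝ≥0∞) + (n : ℝ≥0∞) ^ 2 * ((N : ℝ≥0∞) ^ d)⁻¹ := by
  set μ := uniformPoints d n
  let S : Fin n × Fin n → Set (Fin n → Fin d → ℝ) := fun ij =>
    {x | ij.1 ≠ ij.2 ∧ gridCell N (x ij.1) = gridCell N (x ij.2)}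
  have hS : ∀ ij, μ (S ij) ≤ ((N : ℝ≥0∞) ^ d)⁻¹ := by
    intro ij
    by_cases h : ij.1 = ij.2
    · simp [S, h]
    · exact (measure_mono fun x hx => hx.2).trans (uniformPoints_same_cell_le h)
  -- Measurable hulls of the events `S ij` have the same measure, and allow integrating the sum term
  -- by term.
  have hle : ∀ᵐ x ∂μ, sepNumber x ≤ ((d * (N - 1) : ℕ) : ℝ≥0∞) +
      ∑ ij, (toMeasurable μ (S ij)).indicator 1 x := by
    have h' : ∀ᵐ x ∂μ, ∀ c : Fin (N - 1), ∀ i k, x i k ≠ ((c : ℕ) + 1 : ℝ) / N := by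
      rw [ae_all_iff]
      exact fun c => ae_uniformPoints_coord_ne d n _
    filter_upwards [ae_uniformPoints_mem_Icc d n, h'] with x hx hx'
    refine (sepNumber_le_grid hx hx').trans ?_
    rw [Nat.cast_add, Finset.card_filter, Nat.cast_sum]
    gcongr with ij
    split_ifs with h
    · rw [Set.indicator_of_mem (subset_toMeasurable μ _ h)]; simp
    · simp
  calc _ ≤ ∫⁻ x, (((d * (N - 1) : ℕ) : ℝ≥0∞) +
      ∑ ij, (toMeasurable μ (S ij)).indicator 1 x) ∂μ := lintegral_mono_ae hle
    _ = ((d * (N - 1) : ℕ) : ℝ≥0∞) + ∑ ij, μ (S ij) := by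
      rw [lintegral_add_left measurable_const, lintegral_const, measure_univ, mul_one,
        lintegral_finsetSum _ fun ij _ =>
          measurable_one.indicator (measurableSet_toMeasurable _ _)]
      simp [measurableSet_toMeasurable]
    _ ≤ _ := by
      gcongr
      refine (Finset.sum_le_sum fun ij _ => hS ij).trans ?_
      simp [sq]

theorem rpow_two_div_pow {x : ℝ} (hx : 0 ≤ x) (d : ℕ) :
    (x ^ (2 / ((d : ℝ) + 1))) ^ (d + 1) = x ^ 2 := by
  rw [← Real.rpow_natCast, ← Real.rpow_mul hx]
  push_cast
  rw [div_mul_cancel₀ _ (by positivity)]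
  norm_num

theorem lintegral_sepNumber_le {d : ℕ} (hd : 1 ≤ d) (n : ℕ) :
    ∫⁻ x, sepNumber x ∂(uniformPoints d n) ≤
      ENNReal.ofReal (2 * ((d : ℝ) * (n : ℝ) ^ (2 / ((d : ℝ) + 1)))) := by
  rcases Nat.eq_zero_or_pos n with rfl | hn
  · refine (lintegral_sepNumber_le_grid 1 d 0).trans ?_
    simp
  have hn' : (0 : ℝ) < n := Nat.cast_pos.2 hn
  set r : ℝ := (n : ℝ) ^ (2 / ((d : ℝ) + 1)) with hr
  have hr0 : 0 < r := Real.rpow_pos_of_pos hn' _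
  have hrd : r ^ (d + 1) = (n : ℝ) ^ 2 := rpow_two_div_pow hn'.le d
  have hN : 0 < ⌈r⌉₊ := Nat.ceil_pos.2 hr0
  have : NeZero ⌈r⌉₊ := ⟨hN.ne'⟩
  refine (lintegral_sepNumber_le_grid ⌈r⌉₊ d n).trans ?_
  -- Rounding up costs nothing here: `N` intervals have only `N - 1` inner walls, and `⌈r⌉₊ - 1 ≤
  -- r`.
  have h1 : ((d * (⌈r⌉₊ - 1) : ℕ) : ℝ) ≤ d * r := by
    rw [Nat.cast_mul, Nat.cast_sub hN]
    gcongr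
    have := Nat.ceil_lt_add_one hr0.le
    push_cast; linarith
  have h2 : (n : ℝ) ^ 2 * ((⌈r⌉₊ : ℝ) ^ d)⁻¹ ≤ r := by
    rw [← hrd, ← div_eq_mul_inv, div_le_iff₀ (by positivity), pow_succ, mul_comm]
    gcongr
    exact Nat.le_ceil r
  have hd' : (1 : ℝ) ≤ d := Nat.one_le_cast.2 hd
  calc _ = ENNReal.ofReal ((d * (⌈r⌉₊ - 1) : ℕ) : ℝ) +
        ENNReal.ofReal ((n : ℝ) ^ 2 * ((⌈r⌉₊ : ℝ) ^ d)⁻¹) := by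
        rw [ENNReal.ofReal_natCast, ENNReal.ofReal_mul (by positivity),
          ENNReal.ofReal_inv_of_pos (by positivity), ENNReal.ofReal_pow (by positivity),
          ENNReal.ofReal_pow (by positivity), ENNReal.ofReal_natCast, ENNReal.ofReal_natCast]
    _ ≤ _ := by
      rw [← ENNReal.ofReal_add (by positivity) (by positivity)]
      apply ENNReal.ofReal_le_ofReal
      nlinarith

/-! ### Measurability of the separability -/

/-- The point tuples all of whose pairs are on different sides of one of `k` affine equations. -/
def sepTuples (d n k : ℕ) : Set (Fin n → Fin d → ℝ) :=
  ⋃ h : Fin k → (Fin d → ℝ) × ℝ, ⋂ i : Fin n, ⋂ j : Fin n, ⋂ _ : i ≠ j, ⋃ l : Fin k,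
    {x | ((h l).1 ⬝ᵥ x i - (h l).2) * ((h l).1 ⬝ᵥ x j - (h l).2) < 0}

/-- Strict separation is an open condition, so even the uncountable union over equations causes no
harm. -/
theorem isOpen_sepTuples (d n k : ℕ) : IsOpen (sepTuples d n k) := by
  refine isOpen_iUnion fun h => isOpen_iInter_of_finite fun i => isOpen_iInter_of_finite fun j =>
    isOpen_iInter_of_finite fun _ => isOpen_iUnion fun l => ?_
  apply isOpen_lt _ continuous_const
  simp only [dotProduct]
  fun_prop

theorem separability_le_iff {d n k : ℕ} {x : Fin n → Fin d → ℝ} (hx : Function.Injective x) :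
    separability (Set.range x) ≤ k ↔ x ∈ sepTuples d n k := by
  simp only [sepTuples, Set.mem_iUnion, Set.mem_iInter, Set.mem_ofPred_eq]
  constructor
  · intro h
    obtain ⟨L, ⟨hL, hsep⟩, hcard⟩ := exists_finset_of_separability_le h
    rcases L.eq_empty_or_nonempty with rfl | hne
    · refine ⟨fun _ => 0, fun i j hij => ?_⟩
      obtain ⟨H, hH, -⟩ := hsep _ ⟨i, rfl⟩ _ ⟨j, rfl⟩ (hx.ne hij)
      simp at hH
    -- Repeating members pads `L` to a list of exactly `k` equations.
    obtain ⟨g, hg⟩ : ∃ g : Fin k → L, Function.Surjective g := by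
      have : Nonempty L := hne.to_subtype
      exact ⟨_, Function.invFun_surjective
        ((Fin.castLE_injective hcard).comp L.equivFin.injective)⟩
    choose a b hab using fun H : L => hL H H.2
    refine ⟨fun l => (a (g l), b (g l)), fun i j hij => ?_⟩
    obtain ⟨H, hH, hd⟩ := hsep _ ⟨i, rfl⟩ _ ⟨j, rfl⟩ (hx.ne hij)
    obtain ⟨l, hl⟩ := hg ⟨H, hH⟩
    refine ⟨l, ?_⟩
    rw [show H = _ from (hab ⟨H, hH⟩).2, onDifferentSides_iff] at hd
    simpa [hl] using hd
  · rintro ⟨h, hsep⟩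
    classical
    let L : Finset (Set (Fin d → ℝ)) := (Finset.univ.filter fun l => (h l).1 ≠ 0).image
      fun l => {y | (h l).1 ⬝ᵥ y = (h l).2}
    have hL : IsSeparatingSet (L : Set (Set (Fin d → ℝ))) (Set.range x) := by
      constructor
      · intro H hH
        simp only [L, Finset.mem_coe, Finset.mem_image, Finset.mem_filter, Finset.mem_univ,
          true_and] at hH
        obtain ⟨l, hl, rfl⟩ := hH
        exact ⟨_, _, hl, rfl⟩
      · rintro _ ⟨i, rfl⟩ _ ⟨j, rfl⟩ hij
        obtain ⟨l, hl⟩ := hsep i j fun h => hij (by rw [h])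
        refine ⟨_, ?_, onDifferentSides_iff.2 hl⟩
        simp only [L, Finset.mem_coe, Finset.mem_image, Finset.mem_filter, Finset.mem_univ,
          true_and]
        -- An equation with zero normal takes the same value at both points, so its product is a
        -- square and never negative.
        refine ⟨l, fun h0 => ?_, rfl⟩
        rw [h0] at hl
        simp only [zero_dotProduct, zero_sub, mul_neg, neg_mul, neg_neg] at hl
        exact (mul_self_nonneg _).not_gt hl
    refine (separability_le_encard hL).trans ?_
    rw [Set.encard_coe_eq_coe_finsetCard]
    have : L.card ≤ k := by
      refine Finset.card_image_le.trans ((Finset.card_filter_le _ _).trans (by simp))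
    exact_mod_cast this

theorem aemeasurable_sepNumber {d : ℕ} (hd : 1 ≤ d) (n : ℕ) :
    AEMeasurable (sepNumber (d := d) (n := n)) (uniformPoints d n) := by
  classical
  refine ⟨fun x => ⨅ k : ℕ, if x ∈ sepTuples d n k then (k : ℝ≥0∞) else ⊤,
    Measurable.iInf fun k => Measurable.ite (isOpen_sepTuples d n k).measurableSet
      measurable_const measurable_const, ?_⟩
  filter_upwards [ae_uniformPoints_injective hd n] with x hx
  unfold sepNumber
  apply le_antisymm
  · refine le_iInf fun k => ?_
    split_ifs with h
    · exact_mod_cast ENat.toENNReal_le.2 ((separability_le_iff hx).2 h)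
    · exact le_top
  · induction hs : separability (Set.range x) with
    | top => simp
    | coe k =>
      refine iInf_le_of_le k ?_
      rw [if_pos ((separability_le_iff hx).1 hs.le)]
      simp

/-! ### Covering hyperplanes by few thin slabs -/

/-- The grid cells met by the set `H`. -/
def cellsMeeting (N : ℕ) {d : ℕ} (H : Set (Fin d → ℝ)) : Set (Fin d → Fin N) :=
  {q | ∃ y ∈ H, ∀ k, ((q k : ℕ) : ℝ) ≤ N * y k ∧ N * y k ≤ (q k : ℕ) + 1}

/-- A discretized slab: a thickened hyperplane with integer normal `u`, normalized by
`u k = N`. -/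
def gridSlab (N : ℕ) {d : ℕ} (k : Fin d) (u : Fin d → ℤ) (w : ℤ) : Finset (Fin d → Fin N) :=
  Finset.univ.filter fun q =>
    u k = N ∧ |∑ i, u i * ((q i : ℕ) : ℤ) - N * w| ≤ (2 * d + 1) * N

/-- Once the coordinates other than `k` are fixed, `u k = N` confines `q k` to `4 * d + 3`
consecutive integers, so its residue modulo `4 * d + 3` determines it. -/
theorem card_gridSlab_le {N d : ℕ} (hN : 0 < N) (k : Fin d) (u : Fin d → ℤ) (w : ℤ) :
    (gridSlab N k u w).card ≤ (4 * d + 3) * N ^ (d - 1) := by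
  have hm : 0 < 4 * d + 3 := by omega
  let φ : gridSlab N k u w → ({i : Fin d // i ≠ k} → Fin N) × Fin (4 * d + 3) :=
    fun q => (fun i => q.1 i, ⟨(q.1 k : ℕ) % (4 * d + 3), Nat.mod_lt _ hm⟩)
  have hφ : Function.Injective φ := by
    rintro ⟨q, hq⟩ ⟨r, hr⟩ h
    simp only [φ, Prod.mk.injEq, Fin.mk.injEq] at h
    obtain ⟨h1, h2⟩ := h
    have h1' : ∀ i, i ≠ k → q i = r i := fun i hi => congrFun h1 ⟨i, hi⟩
    simp only [gridSlab, Finset.mem_filter, Finset.mem_univ, true_and] at hq hr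
    have hsum : ∑ i, u i * ((q i : ℕ) : ℤ) - ∑ i, u i * ((r i : ℕ) : ℤ) =
        N * (((q k : ℕ) : ℤ) - (r k : ℕ)) := by
      rw [← Finset.sum_sub_distrib, Finset.sum_eq_single k]
      · rw [hq.1]; ring
      · intro i _ hi; rw [h1' i hi, sub_self]
      · simp
    have hlt : |((q k : ℕ) : ℤ) - (r k : ℕ)| < (4 * d + 3 : ℕ) := by
      have hN' : (0 : ℤ) < N := by exact_mod_cast hN
      have hq2 := abs_le.1 hq.2
      have hr2 := abs_le.1 hr.2
      have e : (N : ℤ) * |((q k : ℕ) : ℤ) - (r k : ℕ)| ≤ N * (4 * d + 2) := by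
        rw [← abs_of_pos hN', ← abs_mul, abs_of_pos hN', ← hsum, abs_le]
        constructor <;> linarith
      have := le_of_mul_le_mul_left e hN'
      push_cast; linarith
    have hk : (q k : ℕ) = r k := by
      have hdvd : ((4 * d + 3 : ℕ) : ℤ) ∣ ((q k : ℕ) : ℤ) - (r k : ℕ) :=
        (Nat.modEq_iff_dvd.1 (show (r k : ℕ) ≡ q k [MOD 4 * d + 3] from h2.symm))
      have := Int.eq_zero_of_abs_lt_dvd hdvd hlt
      omega
    apply Subtype.ext
    funext i
    by_cases hi : i = k
    · rw [hi]; exact Fin.ext hk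
    · exact h1' i hi
  have := Fintype.card_le_of_injective φ hφ
  simp only [Fintype.card_coe, Fintype.card_prod, Fintype.card_pi, Fintype.card_fin,
    Finset.prod_const, Finset.card_univ, Fintype.card_subtype_compl, Fintype.card_unique] at this
  rw [mul_comm]
  convert this using 3

/-- Divide the equation by its largest coefficient, then round `N` times each coefficient down.
Three errors add up to the slab width `(2 * d + 1) * N`: rounding the normal (`d * N`), replacing a
point of the cell by the cell's corner (`d * N`), and rounding the offset (`N`). The range of `w` is
bounded because `H` meets the cube. -/
theorem cellsMeeting_subset_gridSlab {N d : ℕ} (hN : 0 < N) {H : Set (Fin d → ℝ)}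
    (hH : IsHyperplane H) (hne : (cellsMeeting N H).Nonempty) :
    ∃ (k : Fin d) (u : Fin d → ℤ) (w : ℤ), (∀ i, u i ∈ Finset.Icc (-N : ℤ) N) ∧
      w ∈ Finset.Icc (-(d * N) : ℤ) (d * N) ∧ cellsMeeting N H ⊆ gridSlab N k u w := by
  obtain ⟨a, b, ha, rfl⟩ := hH
  have hN' : (0 : ℝ) < N := Nat.cast_pos.2 hN
  obtain ⟨k0, hk0⟩ := Function.ne_iff.1 ha
  obtain ⟨k, -, hk⟩ := Finset.exists_max_image Finset.univ (fun i => |a i|) ⟨k0, Finset.mem_univ _⟩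
  have hak : 0 < |a k| := (abs_pos.2 hk0).trans_le (hk k0 (Finset.mem_univ _))
  have hak0 : a k ≠ 0 := abs_pos.1 hak
  obtain ⟨a', ha'⟩ : ∃ a' : Fin d → ℝ, a' = fun i => a i / a k := ⟨_, rfl⟩
  obtain ⟨b', hb'⟩ : ∃ b' : ℝ, b' = b / a k := ⟨_, rfl⟩
  have hle : ∀ i, |a' i| ≤ 1 := by
    intro i
    rw [ha', abs_div, div_le_one hak]
    exact hk i (Finset.mem_univ _)
  have hak1 : a' k = 1 := by rw [ha']; exact div_self hak0
  have heq : ∀ y, a ⬝ᵥ y = b → ∑ i, a' i * y i = b' := by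
    intro y hy
    rw [hb', ← hy, ha', dotProduct, Finset.sum_div]
    exact Finset.sum_congr rfl fun i _ => by ring
  have hsum : ∀ f : Fin d → ℝ, ∀ c : ℝ, (∀ i, |f i| ≤ c) → |∑ i, f i| ≤ d * c := by
    intro f c h
    refine (Finset.abs_sum_le_sum_abs _ _).trans ((Finset.sum_le_sum fun i _ => h i).trans ?_)
    simp
  have hb1 : |N * b'| ≤ d * N := by
    obtain ⟨q, y, hy, hq⟩ := hne
    rw [← heq y hy, Finset.mul_sum]
    apply hsum
    intro i
    have h0 : (0 : ℝ) ≤ N * y i := (Nat.cast_nonneg _).trans (hq i).1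
    have h1 : N * y i ≤ N := (hq i).2.trans (by exact_mod_cast (q i).2)
    rw [show N * (a' i * y i) = a' i * (N * y i) by ring, abs_mul, abs_of_nonneg h0]
    exact (mul_le_mul (hle i) h1 h0 zero_le_one).trans (by rw [one_mul])
  refine ⟨k, fun i => ⌊N * a' i⌋, ⌊N * b'⌋, fun i => ?_, ?_, ?_⟩
  · have h1 := abs_le.1 (hle i)
    rw [Finset.mem_Icc]
    constructor
    · rw [Int.le_floor]; push_cast; nlinarith
    · rw [← Int.cast_le (R := ℝ)]
      refine (Int.floor_le _).trans ?_
      push_cast; nlinarith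
  · have h1 := abs_le.1 hb1
    rw [Finset.mem_Icc]
    constructor
    · rw [Int.le_floor]; push_cast; exact h1.1
    · rw [← Int.cast_le (R := ℝ)]
      refine (Int.floor_le _).trans ?_
      push_cast; exact h1.2
  · rintro q ⟨y, hy, hq⟩
    simp only [gridSlab, Finset.coe_filter, Finset.mem_univ, true_and, Set.mem_ofPred_eq]
    refine ⟨by rw [hak1, mul_one, Int.floor_natCast], ?_⟩
    rw [← Int.cast_le (R := ℝ)]
    push_cast
    have e : (∑ i, (⌊N * a' i⌋ : ℝ) * ((q i : ℕ) : ℝ)) - N * (⌊N * b'⌋ : ℝ) =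
        ∑ i, ((⌊N * a' i⌋ : ℝ) - N * a' i) * (q i : ℕ) +
        (∑ i, N * (a' i * ((q i : ℕ) - N * y i)) + N * (N * b' - ⌊N * b'⌋)) := by
      rw [← heq y hy, Finset.mul_sum, mul_sub, Finset.mul_sum, ← add_sub_assoc, ← add_sub_assoc,
        ← Finset.sum_add_distrib, ← Finset.sum_add_distrib]
      congr 1
      exact Finset.sum_congr rfl fun i _ => by ring
    have e1 : |∑ i, ((⌊N * a' i⌋ : ℝ) - N * a' i) * (q i : ℕ)| ≤ d * N := by
      apply hsum
      intro i
      rw [abs_mul, Nat.abs_cast]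
      have hq' : ((q i : ℕ) : ℝ) ≤ N := by exact_mod_cast (q i).2.le
      have hf : |(⌊N * a' i⌋ : ℝ) - N * a' i| ≤ 1 := by
        rw [abs_le]
        constructor <;> linarith [Int.floor_le (N * a' i), Int.lt_floor_add_one (N * a' i)]
      exact (mul_le_mul hf hq' (Nat.cast_nonneg _) zero_le_one).trans (by rw [one_mul])
    have e2 : |∑ i, N * (a' i * ((q i : ℕ) - N * y i))| ≤ d * N := by
      apply hsum
      intro i
      rw [abs_mul, Nat.abs_cast, abs_mul]
      have hf : |((q i : ℕ) : ℝ) - N * y i| ≤ 1 := by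
        rw [abs_le]
        constructor <;> linarith [(hq i).1, (hq i).2]
      have := mul_le_mul (hle i) hf (abs_nonneg _) zero_le_one
      nlinarith
    have e3 : |N * (N * b' - ⌊N * b'⌋)| ≤ N := by
      rw [abs_mul, Nat.abs_cast]
      have hf : |N * b' - ⌊N * b'⌋| ≤ 1 := by
        rw [abs_le]
        constructor <;> linarith [Int.floor_le (N * b'), Int.lt_floor_add_one (N * b')]
      nlinarith
    rw [e]
    refine (abs_add_le _ _).trans ?_
    have := abs_add_le (∑ i, N * (a' i * ((q i : ℕ) - N * y i))) (N * (N * b' - ⌊N * b'⌋))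
    linarith

/-- The index set of a family of slabs that covers all hyperplanes. -/
noncomputable def slabIndices (N d : ℕ) : Finset (Fin d × (Fin d → ℤ) × ℤ) :=
  Finset.univ ×ˢ (Fintype.piFinset fun _ => Finset.Icc (-N : ℤ) N) ×ˢ
    Finset.Icc (-(d * N) : ℤ) (d * N)

theorem card_slabIndices_le {N d : ℕ} (hN : 0 < N) (hd : 0 < d) :
    (slabIndices N d).card ≤ 3 ^ (d + 1) * d ^ 2 * N ^ (d + 1) := by
  have h1 : (Finset.Icc (-N : ℤ) N).card ≤ 3 * N := by
    rw [Int.card_Icc]; omega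
  have h2 : (Finset.Icc (-(d * N) : ℤ) (d * N)).card ≤ 3 * (d * N) := by
    have : 0 < d * N := by positivity
    rw [Int.card_Icc]
    have e : ((d : ℤ) * N) = ((d * N : ℕ) : ℤ) := by push_cast; ring
    rw [e]; omega
  simp only [slabIndices, Finset.card_product, Finset.card_univ, Fintype.card_fin,
    Fintype.card_piFinset, Finset.prod_const]
  calc _ ≤ d * ((3 * N) ^ d * (3 * (d * N))) := by gcongr
    _ = _ := by ring

theorem exists_slab_of_isHyperplane {N d : ℕ} (hN : 0 < N) {H : Set (Fin d → ℝ)}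
    (hH : IsHyperplane H) (hne : (cellsMeeting N H).Nonempty) :
    ∃ s ∈ slabIndices N d, cellsMeeting N H ⊆ gridSlab N s.1 s.2.1 s.2.2 := by
  obtain ⟨k, u, w, hu, hw, h⟩ := cellsMeeting_subset_gridSlab hN hH hne
  refine ⟨(k, u, w), ?_, h⟩
  simp only [slabIndices, Finset.mem_product, Finset.mem_univ, true_and, Fintype.mem_piFinset]
  exact ⟨hu, hw⟩

/-! ### Collision cells force many hyperplanes -/

/-- The values taken at least twice by `f`. -/
noncomputable def collisions {ι κ : Type*} [Fintype κ] (f : ι → κ) : Finset κ :=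
  open Classical in Finset.univ.filter fun q => ∃ i j, i ≠ j ∧ f i = q ∧ f j = q

theorem mem_collisions {ι κ : Type*} [Fintype κ] {f : ι → κ} {q : κ} :
    q ∈ collisions f ↔ ∃ i j, i ≠ j ∧ f i = q ∧ f j = q := by
  simp [collisions]

/-- Closed cells are convex, so the crossing point of the segment lies in the common cell. -/
theorem mem_cellsMeeting_of_onDifferentSides {N : ℕ} [NeZero N] {d : ℕ} {p q : Fin d → ℝ}
    {H : Set (Fin d → ℝ)} (hp : ∀ k, p k ∈ Set.Icc (0 : ℝ) 1)
    (hq : ∀ k, q k ∈ Set.Icc (0 : ℝ) 1) (h : gridCell N p = gridCell N q)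
    (hH : OnDifferentSides H p q) : gridCell N p ∈ cellsMeeting N H := by
  obtain ⟨⟨y, hy, s, t, hs, ht, hst, rfl⟩, -, -⟩ := hH
  refine ⟨_, hy, fun k => ?_⟩
  have h1 := gridIndex_bounds (N := N) (hp k)
  have h2 := gridIndex_bounds (N := N) (hq k)
  rw [show gridIndex N (q k) = gridIndex N (p k) from (congrFun h k).symm] at h2
  simp only [Pi.add_apply, Pi.smul_apply, smul_eq_mul, gridCell]
  obtain rfl : t = 1 - s := by linarith
  constructor <;> nlinarith

/-- Every collision cell is met by a member of `L`, and each member, being covered by one slab,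
meets at most `t` of them. -/
theorem card_collisions_le {N : ℕ} [NeZero N] {d n t : ℕ} {x : Fin n → Fin d → ℝ}
    (hx : Function.Injective x) (hx' : ∀ i k, x i k ∈ Set.Icc (0 : ℝ) 1)
    (ht : ∀ s ∈ slabIndices N d,
      (collisions (fun i => gridCell N (x i)) ∩ gridSlab N s.1 s.2.1 s.2.2).card ≤ t)
    (L : Finset (Set (Fin d → ℝ)))
    (hL : IsSeparatingSet (L : Set (Set (Fin d → ℝ))) (Set.range x)) :
    (collisions fun i => gridCell N (x i)).card ≤ t * L.card := by
  classical
  set C := collisions fun i => gridCell N (x i)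
  have h : ∀ q ∈ C, ∃ H ∈ L, q ∈ cellsMeeting N H := by
    intro q hq
    obtain ⟨i, j, hij, rfl, hj⟩ := mem_collisions.1 hq
    obtain ⟨H, hH, hs⟩ := hL.2 _ ⟨i, rfl⟩ _ ⟨j, rfl⟩ (hx.ne hij)
    exact ⟨H, hH, mem_cellsMeeting_of_onDifferentSides (hx' i) (hx' j) hj.symm hs⟩
  have hsub : C ⊆ L.biUnion fun H => C.filter (· ∈ cellsMeeting N H) := by
    intro q hq
    obtain ⟨H, hH, hqH⟩ := h q hq
    exact Finset.mem_biUnion.2 ⟨H, hH, Finset.mem_filter.2 ⟨hq, hqH⟩⟩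
  refine (Finset.card_le_card hsub).trans ((Finset.card_biUnion_le_card_mul _ _ t ?_).trans
    (mul_comm _ _).le)
  intro H hH
  by_cases hne : (cellsMeeting N H).Nonempty
  · obtain ⟨s, hs, hss⟩ := exists_slab_of_isHyperplane (NeZero.pos N) (hL.1 H hH) hne
    refine (Finset.card_le_card ?_).trans (ht s hs)
    intro q hq
    obtain ⟨h1, h2⟩ := Finset.mem_filter.1 hq
    exact Finset.mem_inter.2 ⟨h1, Finset.mem_coe.1 (hss h2)⟩
  · rw [Set.not_nonempty_iff_eq_empty] at hne
    simp [hne]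

/-! ### Counting maps with many or few collisions -/

section Collisions

variable {κ : Type*} [Fintype κ]

/-- Such a map is determined by one value in `A` for each of the `t` pairs and by its values at the
`n - 2 * t` unpaired indices. -/
theorem card_filter_pairs_le [DecidableEq κ] {n t : ℕ} (e : Fin t × Bool ↪ Fin n) (A : Finset κ) :
    (Finset.univ.filter fun f : Fin n → κ =>
      ∀ s, f (e (s, true)) = f (e (s, false)) ∧ f (e (s, true)) ∈ A).card ≤
      A.card ^ t * Fintype.card κ ^ (n - 2 * t) := by
  have := Fintype.card_le_of_injective
    (fun f : {f : Fin n → κ //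
        ∀ s, f (e (s, true)) = f (e (s, false)) ∧ f (e (s, true)) ∈ A} =>
      ((fun s => ⟨f.1 (e (s, true)), (f.2 s).2⟩, fun i => f.1 i) :
        (Fin t → A) × (((Finset.univ.map e)ᶜ : Finset (Fin n)) → κ))) (by
      rintro ⟨f, hf⟩ ⟨g, hg⟩ h
      simp only [Prod.mk.injEq] at h
      have h1 : ∀ s, f (e (s, true)) = g (e (s, true)) := fun s =>
        congrArg Subtype.val (congrFun h.1 s)
      apply Subtype.ext
      funext i
      by_cases hi : i ∈ Finset.univ.map e
      · obtain ⟨⟨s, b⟩, -, rfl⟩ := Finset.mem_map.1 hi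
        cases b
        · exact (hf s).1.symm.trans ((h1 s).trans (hg s).1)
        · exact h1 s
      · exact congrFun h.2 ⟨i, Finset.mem_compl.2 hi⟩)
  rw [Fintype.card_subtype] at this
  simpa only [Fintype.card_prod, Fintype.card_fun, Fintype.card_coe, Fintype.card_fin,
    Finset.card_compl, Finset.card_map, Finset.card_univ, Fintype.card_bool, mul_comm t 2]
    using this

/-- Pick two preimages of each of `t` collision values; every ordering of these pairs gives a
different embedding. -/
theorem factorial_le_card_pairs [DecidableEq κ] {n t : ℕ} (f : Fin n → κ) (A : Finset κ)
    (h : t ≤ (collisions f ∩ A).card) :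
    t.factorial ≤ (Finset.univ.filter fun e : Fin t × Bool ↪ Fin n =>
      ∀ s, f (e (s, true)) = f (e (s, false)) ∧ f (e (s, true)) ∈ A).card := by
  let c : Fin t → κ := fun s => ((collisions f ∩ A).equivFin.symm (Fin.castLE h s)).1
  have hc : ∀ s, c s ∈ collisions f ∩ A := fun s => Subtype.prop _
  have hcinj : Function.Injective c := by
    intro s s' hs
    exact Fin.castLE_injective h ((collisions f ∩ A).equivFin.symm.injective (Subtype.ext hs))
  choose i j hij hi hj using fun s => mem_collisions.1 (Finset.mem_inter.1 (hc s)).1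
  let e₀ : Fin t × Bool ↪ Fin n := ⟨fun sb => if sb.2 then i sb.1 else j sb.1, by
    have hf : ∀ sb : Fin t × Bool, f (if sb.2 then i sb.1 else j sb.1) = c sb.1 := by
      rintro ⟨s, b⟩
      cases b
      · exact hj s
      · exact hi s
    intro x y hxy
    have h1 : x.1 = y.1 := hcinj (by rw [← hf x, ← hf y]; exact congrArg f hxy)
    obtain ⟨s, b⟩ := x
    obtain ⟨s', b'⟩ := y
    obtain rfl : s = s' := h1
    cases b <;> cases b'
    · rfl
    · exact absurd hxy.symm (hij s)
    · exact absurd hxy (hij s)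
    · rfl⟩
  have he₀ : ∀ s, e₀ (s, true) = i s ∧ e₀ (s, false) = j s := fun s => ⟨rfl, rfl⟩
  let F : Equiv.Perm (Fin t) → (Fin t × Bool ↪ Fin n) := fun σ =>
    (Equiv.prodCongr σ (Equiv.refl Bool)).toEmbedding.trans e₀
  have hF : ∀ σ s b, F σ (s, b) = e₀ (σ s, b) := fun σ s b => rfl
  have hFinj : Function.Injective F := by
    intro σ τ hστ
    ext s : 1
    have := DFunLike.congr_fun hστ (s, true)
    rw [hF, hF] at this
    exact congrArg Prod.fst (e₀.injective this)
  calc t.factorial = (Finset.univ.map ⟨F, hFinj⟩).card := by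
        simp [Fintype.card_perm]
    _ ≤ _ := by
      apply Finset.card_le_card
      intro e he
      obtain ⟨σ, -, rfl⟩ := Finset.mem_map.1 he
      simp only [Finset.mem_filter, Finset.mem_univ, true_and, Function.Embedding.coeFn_mk, hF,
        (he₀ _).1, (he₀ _).2, hi, hj]
      exact fun s => (Finset.mem_inter.1 (hc _)).2

/-- Double counting of maps against ordered families of `t` disjoint colliding pairs. The `t!`
gained from the orderings is what eventually yields the `log log n` factor. -/
theorem card_collisions_inter_ge_mul_le [DecidableEq κ] (n t : ℕ) (A : Finset κ) :
    (Finset.univ.filter fun f : Fin n → κ => t ≤ (collisions f ∩ A).card).card * t.factorial *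
      Fintype.card κ ^ (2 * t) ≤ n ^ (2 * t) * A.card ^ t * Fintype.card κ ^ n := by
  have h := Finset.card_mul_le_card_mul
    (fun (f : Fin n → κ) (e : Fin t × Bool ↪ Fin n) =>
      ∀ s, f (e (s, true)) = f (e (s, false)) ∧ f (e (s, true)) ∈ A)
    (s := Finset.univ.filter fun f : Fin n → κ => t ≤ (collisions f ∩ A).card)
    (t := Finset.univ) (m := t.factorial) (n := A.card ^ t * Fintype.card κ ^ (n - 2 * t))
    (fun f hf => factorial_le_card_pairs f A (Finset.mem_filter.1 hf).2)
    (fun e _ => (Finset.card_le_card (Finset.filter_subset_filter _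
      (Finset.subset_univ _))).trans (card_filter_pairs_le e A))
  rw [Finset.card_univ, Fintype.card_embedding_eq] at h
  simp only [Fintype.card_prod, Fintype.card_fin, Fintype.card_bool] at h
  rw [mul_comm t 2] at h
  by_cases hn : 2 * t ≤ n
  · calc _ ≤ n.descFactorial (2 * t) * (A.card ^ t * Fintype.card κ ^ (n - 2 * t)) *
          Fintype.card κ ^ (2 * t) := Nat.mul_le_mul_right _ h
      _ ≤ n ^ (2 * t) * (A.card ^ t * Fintype.card κ ^ (n - 2 * t)) *
          Fintype.card κ ^ (2 * t) := by
        gcongr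
        exact Nat.descFactorial_le_pow _ _
      _ = n ^ (2 * t) * A.card ^ t * Fintype.card κ ^ (n - 2 * t + 2 * t) := by ring
      _ = _ := by rw [Nat.sub_add_cancel hn]
  -- With `2 * t > n` there is no embedding, hence no such map.
  · rw [Nat.descFactorial_eq_zero_iff_lt.2 (not_le.1 hn), zero_mul] at h
    rw [Nat.le_zero.1 h, zero_mul]
    exact Nat.zero_le _

/-- An exponential moment bound: with weight `1 / 4` on `R` and `4` off it, a map with under half
its values in `R` has weight product at least `1`, while the mean weight is at most `1 / 4 + 4 / 16
= 1 / 2`. -/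
theorem card_filter_few_mem_le [DecidableEq κ] (a : ℕ) (R : Finset κ)
    (hR : 16 * Rᶜ.card ≤ Fintype.card κ) :
    ((Finset.univ.filter fun f : Fin a → κ =>
      2 * (Finset.univ.filter fun i => f i ∈ R).card < a).card : ℝ) ≤
      (1 / 2) ^ a * (Fintype.card κ : ℝ) ^ a := by
  let w : κ → ℝ := fun q => if q ∈ R then 1 / 4 else 4
  have hw : ∀ q, 0 ≤ w q := fun q => by simp only [w]; split_ifs <;> norm_num
  have hsum : ∑ q, w q ≤ 1 / 2 * Fintype.card κ := by
    have h1 : ∑ q, w q = R.card * (1 / 4) + Rᶜ.card * 4 := by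
      rw [← Finset.sum_add_sum_compl R]
      congr 1
      · rw [Finset.sum_congr rfl fun q hq => if_pos hq]; simp
      · rw [Finset.sum_congr rfl fun q hq => if_neg (Finset.mem_compl.1 hq)]; simp
    have h2 : (R.card : ℝ) ≤ Fintype.card κ := by exact_mod_cast Finset.card_le_univ R
    have h3 : 16 * (Rᶜ.card : ℝ) ≤ Fintype.card κ := by exact_mod_cast hR
    rw [h1]; linarith
  have hprod : ∀ f : Fin a → κ, 2 * (Finset.univ.filter fun i => f i ∈ R).card < a →
      1 ≤ ∏ i, w (f i) := by
    intro f hf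
    simp only [w]
    rw [Finset.prod_ite, Finset.prod_const, Finset.prod_const]
    have hadd := Finset.card_filter_add_card_filter_not (s := (Finset.univ : Finset (Fin a)))
      (fun i => f i ∈ R)
    rw [Finset.card_univ, Fintype.card_fin] at hadd
    obtain ⟨m, hm⟩ : ∃ m, (Finset.univ.filter fun i => ¬ f i ∈ R).card =
      (Finset.univ.filter fun i => f i ∈ R).card + m := ⟨_, (Nat.add_sub_of_le (by omega)).symm⟩
    rw [hm, pow_add, ← mul_assoc, ← mul_pow]
    norm_num
    exact one_le_pow₀ (by norm_num)
  rw [← mul_pow]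
  refine le_trans ?_ (pow_le_pow_left₀ (Finset.sum_nonneg fun q _ => hw q) hsum a)
  rw [Fintype.sum_pow, Finset.card_filter, Nat.cast_sum]
  refine Finset.sum_le_sum fun f _ => ?_
  split_ifs with h
  · simpa using hprod f h
  · simpa using Finset.prod_nonneg fun i _ => hw (f i)

/-- Expose the first `a` values, then the other `b`. Unless fewer than half of the first values lie
in `R`, they occupy at least `a / 2` distinct elements of `R`, as no collision lies there. All later
values must avoid these, which has probability at most `(1 - a / (2 * M)) ^ b`. -/
theorem card_disjoint_collisions_le [DecidableEq κ] (a b : ℕ) (R : Finset κ)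
    (hR : 16 * Rᶜ.card ≤ Fintype.card κ) (hM : 0 < Fintype.card κ) :
    ((Finset.univ.filter fun f : Fin (a + b) → κ => Disjoint (collisions f) R).card : ℝ) ≤
      ((1 / 2) ^ a + Real.exp (-(a * b / (2 * Fintype.card κ)))) *
        (Fintype.card κ : ℝ) ^ (a + b) := by
  set M := Fintype.card κ with hMdef
  have hM' : (0 : ℝ) < M := Nat.cast_pos.2 hM
  let B : (Fin a → κ) → Finset κ := fun f => (Finset.univ.filter fun i => f i ∈ R).image f
  let S : Finset ((Fin a → κ) × (Fin b → κ)) := Finset.univ.filter fun f =>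
    Disjoint (collisions f.1) R ∧ ∀ j, f.2 j ∉ B f.1
  have h1 : (Finset.univ.filter fun f : Fin (a + b) → κ => Disjoint (collisions f) R).card ≤
      S.card := by
    apply Finset.card_le_card_of_injOn (Fin.appendEquiv a b).symm
    · intro f hf
      have hf' : Disjoint (collisions f) R := by simpa using hf
      rw [Finset.disjoint_left] at hf'
      simp only [S, Finset.coe_filter, Finset.mem_univ, true_and, Set.mem_ofPred_eq]
      constructor
      · rw [Finset.disjoint_left]
        intro q hq
        obtain ⟨i, j, hij, hi, hj⟩ := mem_collisions.1 hq
        exact hf' (mem_collisions.2 ⟨Fin.castAdd b i, Fin.castAdd b j,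
          fun h => hij (Fin.castAdd_injective _ _ h), hi, hj⟩)
      · intro j hj
        obtain ⟨i, hi, hij⟩ := Finset.mem_image.1 hj
        refine hf' (mem_collisions.2 ⟨Fin.castAdd b i, Fin.natAdd a j, ?_, rfl, hij.symm⟩)
          (Finset.mem_filter.1 hi).2
        intro h
        have := congrArg Fin.val h
        simp only [Fin.val_castAdd, Fin.val_natAdd] at this
        omega
    · exact (Fin.appendEquiv a b).symm.injective.injOn
  have h2 : ∀ f : Fin a → κ, ((Finset.univ.filter fun g : Fin b → κ =>
      Disjoint (collisions f) R ∧ ∀ j, g j ∉ B f).card : ℝ) ≤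
      ((if 2 * (Finset.univ.filter fun i => f i ∈ R).card < a then 1 else 0) +
        Real.exp (-(a * b / (2 * M)))) * (M : ℝ) ^ b := by
    intro f
    by_cases hd : Disjoint (collisions f) R
    swap
    · simp only [hd, false_and, Finset.filter_false, Finset.card_empty, Nat.cast_zero]
      positivity
    have hle : ((Finset.univ.filter fun g : Fin b → κ =>
        Disjoint (collisions f) R ∧ ∀ j, g j ∉ B f).card) = (M - (B f).card) ^ b := by
      have : (Finset.univ.filter fun g : Fin b → κ =>
          Disjoint (collisions f) R ∧ ∀ j, g j ∉ B f) =
          Fintype.piFinset fun _ : Fin b => (B f)ᶜ := by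
        ext g
        simp [hd, Fintype.mem_piFinset]
      rw [this, Fintype.card_piFinset]
      simp [Finset.card_compl, hMdef]
    rw [hle]
    split_ifs with hlt
    · calc (((M - (B f).card) ^ b : ℕ) : ℝ) ≤ ((M ^ b : ℕ) : ℝ) := by
            gcongr
            exact Nat.sub_le _ _
        _ ≤ _ := by
          push_cast
          have := Real.exp_pos (-(a * b / (2 * M) : ℝ))
          have : (0 : ℝ) < (M : ℝ) ^ b := by positivity
          nlinarith
    · have hB : (B f).card = (Finset.univ.filter fun i => f i ∈ R).card := by
        apply Finset.card_image_of_injOn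
        intro i hi j _ hij
        by_contra hne
        exact Finset.disjoint_left.1 hd (mem_collisions.2 ⟨i, j, hne, rfl, hij.symm⟩)
          (Finset.mem_filter.1 (Finset.mem_coe.1 hi)).2
      rw [← hB] at hlt
      have hBM : (B f).card ≤ M := Finset.card_le_univ _
      have hB2 : (a : ℝ) ≤ 2 * (B f).card := by exact_mod_cast not_lt.1 hlt
      push_cast [Nat.cast_sub hBM]
      rw [zero_add]
      have h0 : (0 : ℝ) ≤ M - (B f).card := by
        rw [sub_nonneg]; exact_mod_cast hBM
      have : (M : ℝ) - (B f).card ≤ Real.exp (-(a / (2 * M))) * M := by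
        have h3 := Real.add_one_le_exp (-(a / (2 * M)) : ℝ)
        calc (M : ℝ) - (B f).card ≤ (-(a / (2 * M)) + 1) * M := by
              field_simp; linarith
          _ ≤ _ := by gcongr
      calc ((M : ℝ) - (B f).card) ^ b ≤ (Real.exp (-(a / (2 * M))) * M) ^ b := by gcongr
        _ = _ := by
          rw [mul_pow, ← Real.exp_nat_mul]
          congr 2
          ring
  calc ((Finset.univ.filter fun f : Fin (a + b) → κ => Disjoint (collisions f) R).card : ℝ)
      ≤ (S.card : ℝ) := by exact_mod_cast h1
    _ = ∑ f : Fin a → κ, ((Finset.univ.filter fun g : Fin b → κ =>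
      Disjoint (collisions f) R ∧ ∀ j, g j ∉ B f).card : ℝ) := by
        simp only [S, Finset.card_filter]
        rw [Fintype.sum_prod_type]
        push_cast
        rfl
    _ ≤ ∑ f : Fin a → κ, ((if 2 * (Finset.univ.filter fun i => f i ∈ R).card < a then 1 else 0) +
        Real.exp (-(a * b / (2 * M)))) * (M : ℝ) ^ b := Finset.sum_le_sum fun f _ => h2 f
    _ = (((Finset.univ.filter fun f : Fin a → κ =>
          2 * (Finset.univ.filter fun i => f i ∈ R).card < a).card : ℝ) +
          M ^ a * Real.exp (-(a * b / (2 * M)))) * (M : ℝ) ^ b := by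
        rw [← Finset.sum_mul, Finset.sum_add_distrib, Finset.card_filter]
        simp [hMdef]
    _ ≤ ((1 / 2) ^ a * (M : ℝ) ^ a +
          M ^ a * Real.exp (-(a * b / (2 * M)))) * (M : ℝ) ^ b := by
        gcongr
        exact card_filter_few_mem_le a R hR
    _ = _ := by ring

/-- Few collisions occupy few of the `N` fibres of `g`, so the union bound runs over the at most `2
^ N` sets of fibres instead of the far more numerous sets of cells. At most a sixteenth of all cells
lie in the occupied fibres. -/
theorem card_few_collisions_le [DecidableEq κ] (a b : ℕ) {N : ℕ} (hN : 0 < N) (g : κ → Fin N)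
    (hg : ∀ c, N * (Finset.univ.filter fun q => g q = c).card ≤ Fintype.card κ)
    (hM : 0 < Fintype.card κ) :
    ((Finset.univ.filter fun f : Fin (a + b) → κ => 16 * (collisions f).card ≤ N).card : ℝ) ≤
      2 ^ N * (((1 / 2) ^ a + Real.exp (-(a * b / (2 * Fintype.card κ)))) *
        (Fintype.card κ : ℝ) ^ (a + b)) := by
  let 𝒯 : Finset (Finset (Fin N)) := Finset.univ.filter fun T => 16 * T.card ≤ N
  let R : Finset (Fin N) → Finset κ := fun T => Finset.univ.filter fun q => g q ∉ T
  have hR : ∀ T ∈ 𝒯, 16 * (R T)ᶜ.card ≤ Fintype.card κ := by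
    intro T hT
    have hT' : 16 * T.card ≤ N := (Finset.mem_filter.1 hT).2
    have hsub : (R T)ᶜ ⊆ T.biUnion fun c => Finset.univ.filter fun q => g q = c := by
      intro q hq
      simpa [R] using hq
    have h1 := (Finset.card_le_card hsub).trans Finset.card_biUnion_le
    have h2 : N * (R T)ᶜ.card ≤ T.card * Fintype.card κ := by
      calc N * (R T)ᶜ.card ≤ N * ∑ c ∈ T, (Finset.univ.filter fun q => g q = c).card :=
            Nat.mul_le_mul_left _ h1
        _ = ∑ c ∈ T, N * (Finset.univ.filter fun q => g q = c).card := Finset.mul_sum _ _ _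
        _ ≤ ∑ c ∈ T, Fintype.card κ := Finset.sum_le_sum fun c _ => hg c
        _ = _ := by simp
    refine Nat.le_of_mul_le_mul_left ?_ hN
    calc N * (16 * (R T)ᶜ.card) = 16 * (N * (R T)ᶜ.card) := by ring
      _ ≤ 16 * (T.card * Fintype.card κ) := Nat.mul_le_mul_left _ h2
      _ = (16 * T.card) * Fintype.card κ := by ring
      _ ≤ _ := Nat.mul_le_mul_right _ hT'
  have hsub : (Finset.univ.filter fun f : Fin (a + b) → κ => 16 * (collisions f).card ≤ N) ⊆
      𝒯.biUnion fun T => Finset.univ.filter fun f : Fin (a + b) → κ =>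
        Disjoint (collisions f) (R T) := by
    intro f hf
    have hf' := (Finset.mem_filter.1 hf).2
    refine Finset.mem_biUnion.2 ⟨(collisions f).image g, ?_, ?_⟩
    · simp only [𝒯, Finset.mem_filter, Finset.mem_univ, true_and]
      exact (Nat.mul_le_mul_left _ Finset.card_image_le).trans hf'
    · simp only [R, Finset.mem_filter, Finset.mem_univ, true_and]
      rw [Finset.disjoint_left]
      intro q hq hq'
      exact (Finset.mem_filter.1 hq').2 (Finset.mem_image_of_mem g hq)
  have hcard : (𝒯.card : ℝ) ≤ 2 ^ N := by
    have : 𝒯.card ≤ 2 ^ N := (Finset.card_filter_le _ _).trans (by simp)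
    exact_mod_cast this
  calc _ ≤ ((∑ T ∈ 𝒯, (Finset.univ.filter fun f : Fin (a + b) → κ =>
        Disjoint (collisions f) (R T)).card : ℕ) : ℝ) := by
        exact_mod_cast (Finset.card_le_card hsub).trans Finset.card_biUnion_le
    _ ≤ ∑ T ∈ 𝒯, ((1 / 2) ^ a + Real.exp (-(a * b / (2 * Fintype.card κ)))) *
        (Fintype.card κ : ℝ) ^ (a + b) := by
        rw [Nat.cast_sum]
        exact Finset.sum_le_sum fun T hT => card_disjoint_collisions_le a b (R T) (hR T hT) hM
    _ = 𝒯.card * (((1 / 2) ^ a + Real.exp (-(a * b / (2 * Fintype.card κ)))) *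
        (Fintype.card κ : ℝ) ^ (a + b)) := by rw [Finset.sum_const, nsmul_eq_mul]
    _ ≤ _ := by gcongr

end Collisions

/-! ### The lower-bound failure probability for given `N` and `t` -/

theorem card_gridCell_slice {N d : ℕ} (k : Fin d) (c : Fin N) :
    N * (Finset.univ.filter fun q : Fin d → Fin N => q k = c).card ≤
      Fintype.card (Fin d → Fin N) := by
  have h : (Finset.univ.filter fun q : Fin d → Fin N => q k = c).card ≤ N ^ (d - 1) := by
    have := Fintype.card_le_of_injective
      (fun (q : {q : Fin d → Fin N // q k = c}) (i : {i : Fin d // i ≠ k}) => q.1 i) (by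
        rintro ⟨q, hq⟩ ⟨r, hr⟩ h
        apply Subtype.ext
        funext i
        by_cases hi : i = k
        · rw [hi]; exact hq.trans hr.symm
        · exact congrFun h ⟨i, hi⟩)
    rw [Fintype.card_subtype] at this
    simpa using this
  have hd : d - 1 + 1 = d := by have := k.2; omega
  calc _ ≤ N * N ^ (d - 1) := Nat.mul_le_mul_left _ h
    _ = N ^ (d - 1 + 1) := by ring
    _ = _ := by rw [hd]; simp

theorem card_slab_collisions_ge_le {N d : ℕ} (hN : 0 < N) (hd : 0 < d) (n t : ℕ)
    (s : Fin d × (Fin d → ℤ) × ℤ) :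
    ((Finset.univ.filter fun f : Fin n → Fin d → Fin N =>
      t ≤ (collisions f ∩ gridSlab N s.1 s.2.1 s.2.2).card).card : ℝ) ≤
      ((n : ℝ) ^ 2 * (4 * d + 3) / (N : ℝ) ^ (d + 1)) ^ t / t.factorial *
        ((N : ℝ) ^ d) ^ n := by
  have hN' : (0 : ℝ) < N := Nat.cast_pos.2 hN
  have h := card_collisions_inter_ge_mul_le n t (gridSlab N s.1 s.2.1 s.2.2)
  simp only [Fintype.card_fun, Fintype.card_fin] at h
  set X := (Finset.univ.filter fun f : Fin n → Fin d → Fin N =>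
      t ≤ (collisions f ∩ gridSlab N s.1 s.2.1 s.2.2).card).card
  have h2 : X * t.factorial * (N ^ d) ^ (2 * t) ≤
      n ^ (2 * t) * ((4 * d + 3) * N ^ (d - 1)) ^ t * (N ^ d) ^ n := by
    refine h.trans ?_
    gcongr
    exact card_gridSlab_le hN _ _ _
  have h3 : (X : ℝ) * t.factorial * ((N : ℝ) ^ d) ^ (2 * t) ≤
      (n : ℝ) ^ (2 * t) * ((4 * d + 3) * (N : ℝ) ^ (d - 1)) ^ t * ((N : ℝ) ^ d) ^ n := by
    exact_mod_cast h2
  obtain ⟨m, rfl⟩ : ∃ m, d = m + 1 := ⟨d - 1, by omega⟩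
  rw [← mul_le_mul_iff_left₀ (show (0 : ℝ) < t.factorial * ((N : ℝ) ^ (m + 1)) ^ (2 * t) by
    positivity), ← mul_assoc]
  refine h3.trans (le_of_eq ?_)
  rw [Nat.add_sub_cancel]
  have e : (n : ℝ) ^ 2 * (4 * (m + 1 : ℕ) + 3) / (N : ℝ) ^ (m + 1 + 1) * ((N : ℝ) ^ (m + 1)) ^ 2 =
      (n : ℝ) ^ 2 * ((4 * (m + 1 : ℕ) + 3) * (N : ℝ) ^ m) := by
    field_simp
    ring
  rw [pow_mul, pow_mul, ← mul_pow, ← e, mul_pow]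
  field_simp

theorem uniformPoints_sepNumber_lt_le {N d : ℕ} (hN : 0 < N) (hd : 0 < d) {a b n t : ℕ}
    (hab : a + b = n) (ht : 0 < t) :
    uniformPoints d n {x | sepNumber x < ENNReal.ofReal (N / (16 * t))} ≤
      ENNReal.ofReal (2 ^ N * ((1 / 2) ^ a + Real.exp (-(a * b / (2 * (N : ℝ) ^ d)))) +
        3 ^ (d + 1) * d ^ 2 * N ^ (d + 1) *
          (((n : ℝ) ^ 2 * (4 * d + 3) / (N : ℝ) ^ (d + 1)) ^ t / t.factorial)) := by
  classical
  subst hab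
  set n := a + b
  have : NeZero N := ⟨hN.ne'⟩
  have hN' : (0 : ℝ) < N := Nat.cast_pos.2 hN
  let E₁ : Finset (Fin n → Fin d → Fin N) := Finset.univ.filter fun f => 16 * (collisions f).card ≤ N
  let E₂ : Fin d × (Fin d → ℤ) × ℤ → Finset (Fin n → Fin d → Fin N) := fun s =>
    Finset.univ.filter fun f => t ≤ (collisions f ∩ gridSlab N s.1 s.2.1 s.2.2).card
  let E := E₁ ∪ (slabIndices N d).biUnion E₂
  have hE₁ := card_few_collisions_le a b hN (fun q : Fin d → Fin N => q ⟨0, hd⟩)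
    (card_gridCell_slice _) Fintype.card_pos
  have hZ : ((slabIndices N d).card : ℝ) ≤ 3 ^ (d + 1) * d ^ 2 * N ^ (d + 1) := by
    exact_mod_cast card_slabIndices_le hN hd
  have hE : (E.card : ℝ) ≤ (2 ^ N * ((1 / 2) ^ a + Real.exp (-(a * b / (2 * (N : ℝ) ^ d)))) +
        3 ^ (d + 1) * d ^ 2 * N ^ (d + 1) *
          (((n : ℝ) ^ 2 * (4 * d + 3) / (N : ℝ) ^ (d + 1)) ^ t / t.factorial)) *
          ((N : ℝ) ^ d) ^ n := by
    calc (E.card : ℝ) ≤ E₁.card + ∑ s ∈ slabIndices N d, ((E₂ s).card : ℝ) := by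
          exact_mod_cast (Finset.card_union_le _ _).trans
            (Nat.add_le_add_left Finset.card_biUnion_le _)
      _ ≤ 2 ^ N * (((1 / 2) ^ a + Real.exp (-(a * b / (2 * (N : ℝ) ^ d)))) * ((N : ℝ) ^ d) ^ n) +
          ∑ s ∈ slabIndices N d,
            ((n : ℝ) ^ 2 * (4 * d + 3) / (N : ℝ) ^ (d + 1)) ^ t / t.factorial *
              ((N : ℝ) ^ d) ^ n := by
          refine add_le_add ?_ (Finset.sum_le_sum fun s _ =>
            card_slab_collisions_ge_le hN hd n t s)
          simpa only [Fintype.card_fun, Fintype.card_fin, Nat.cast_pow] using hE₁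
      _ ≤ _ := by
          rw [Finset.sum_const, nsmul_eq_mul, ← mul_assoc (2 ^ N),
            ← mul_assoc ((slabIndices N d).card : ℝ), ← add_mul]
          gcongr
  -- Outside `E`, a separating set of at most `k` hyperplanes gives `N / 16 < |C| ≤ t * k` for the
  -- set `C` of collision cells.
  have hsub : {x | sepNumber x < ENNReal.ofReal (N / (16 * t))} ≤ᵐ[uniformPoints d n]
      {x | (fun i => gridCell N (x i)) ∈ E} := by
    filter_upwards [ae_uniformPoints_injective hd n, ae_uniformPoints_mem_Icc d n]
      with x hx hx' hlt
    by_contra hnot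
    have hnot' : (fun i => gridCell N (x i)) ∉ E := hnot
    simp only [E, E₁, E₂, Finset.mem_union, Finset.mem_filter, Finset.mem_univ, true_and,
      Finset.mem_biUnion, not_or, not_exists, not_and, not_le] at hnot'
    obtain ⟨h1, h2⟩ := hnot'
    have hlt' : sepNumber x < ENNReal.ofReal (N / (16 * t)) := hlt
    unfold sepNumber at hlt'
    induction hs : separability (Set.range x) with
    | top => rw [hs] at hlt'; simp at hlt'
    | coe k =>
      obtain ⟨L, hL, hLk⟩ := exists_finset_of_separability_le hs.le
      have hC := card_collisions_le hx hx' (fun s hs => (h2 s hs).le) L hL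
      rw [hs, ENat.toENNReal_coe, ← ENNReal.ofReal_natCast, ENNReal.ofReal_lt_ofReal_iff_of_nonneg
        (Nat.cast_nonneg _), lt_div_iff₀ (by positivity)] at hlt'
      have hlt2 : k * (16 * t) < N := by exact_mod_cast hlt'
      have : t * L.card ≤ t * k := Nat.mul_le_mul_left _ hLk
      linarith
  refine (measure_mono_ae hsub).trans ((uniformPoints_gridCell_le E).trans ?_)
  rw [show (E.card : ℝ≥0∞) * (((N : ℝ≥0∞) ^ d) ^ n)⁻¹ =
    ENNReal.ofReal (E.card * (((N : ℝ) ^ d) ^ n)⁻¹) by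
      rw [ENNReal.ofReal_mul (by positivity), ENNReal.ofReal_inv_of_pos (by positivity),
        ENNReal.ofReal_pow (by positivity), ENNReal.ofReal_pow (by positivity),
        ENNReal.ofReal_natCast, ENNReal.ofReal_natCast]]
  apply ENNReal.ofReal_le_ofReal
  rw [← div_eq_mul_inv, div_le_iff₀ (by positivity)]
  exact hE

/-! ### Choice of parameters and asymptotics -/

open Filter in
theorem eventually_pow_div_factorial_le {β K : ℝ} (hβ : 0 < β) (hK : 0 < K) :
    ∀ᶠ y : ℝ in atTop, 0 < Real.log y ∧ 0 < ⌈K * y / Real.log y⌉₊ ∧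
      (⌈K * y / Real.log y⌉₊ : ℝ) ≤ 2 * (K * y / Real.log y) ∧
      β ^ ⌈K * y / Real.log y⌉₊ / (⌈K * y / Real.log y⌉₊).factorial ≤ Real.exp (-(K / 2 * y)) := by
  have hc : 0 < K / (Real.exp 1 * β) := by positivity
  filter_upwards [eventually_gt_atTop (1 : ℝ),
    (isLittleO_log_rpow_atTop (r := 1 / 2) (by norm_num)).bound hc,
    Real.isLittleO_log_id_atTop.bound hK] with y hy h1 h2
  have hy0 : 0 < y := one_pos.trans hy
  have hlog : 0 < Real.log y := Real.log_pos hy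
  have hs : y ^ (1 / 2 : ℝ) = Real.exp (Real.log y / 2) := by
    rw [Real.rpow_def_of_pos hy0]; congr 1; ring
  have hs2 : Real.exp (Real.log y / 2) * Real.exp (Real.log y / 2) = y := by
    rw [← Real.exp_add, add_halves, Real.exp_log hy0]
  set s := Real.exp (Real.log y / 2) with hsdef
  have hs0 : 0 < s := Real.exp_pos _
  rw [hs, Real.norm_of_nonneg hlog.le, Real.norm_of_nonneg hs0.le, div_mul_eq_mul_div,
    le_div_iff₀ (by positivity)] at h1
  rw [Real.norm_of_nonneg hlog.le, id, Real.norm_of_nonneg hy0.le] at h2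
  set z := K * y / Real.log y with hz
  have hz1 : 1 ≤ z := by rw [hz, le_div_iff₀ hlog, one_mul]; exact h2
  -- With `s = √y`, this turns `β ^ t / t! ≤ (e * β / t) ^ t` into at most `s⁻¹ ^ t`; then `t * log
  -- y ≥ K * y` finishes.
  have hzs : Real.exp 1 * β * s ≤ z := by
    rw [hz, le_div_iff₀ hlog]
    calc Real.exp 1 * β * s * Real.log y = Real.log y * (Real.exp 1 * β) * s := by ring
      _ ≤ K * s * s := by gcongr
      _ = K * y := by rw [mul_assoc, hs2]
  have htz : z ≤ ⌈z⌉₊ := Nat.le_ceil z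
  have ht : 0 < ⌈z⌉₊ := Nat.ceil_pos.2 (one_pos.trans_le hz1)
  refine ⟨hlog, ht, ?_, ?_⟩
  · have := Nat.ceil_lt_add_one (zero_le_one.trans hz1)
    linarith
  · set t := ⌈z⌉₊
    have ht' : (0 : ℝ) < t := Nat.cast_pos.2 ht
    calc β ^ t / t.factorial = (β / t) ^ t * ((t : ℝ) ^ t / t.factorial) := by
          rw [div_pow]; field_simp
      _ ≤ (β / t) ^ t * Real.exp t := by
          gcongr
          exact Real.pow_div_factorial_le_exp t ht'.le t
      _ = (Real.exp 1 * β / t) ^ t := by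
          rw [← Real.exp_one_pow, ← mul_pow]; congr 1; ring
      _ ≤ (s⁻¹) ^ t := by
          gcongr
          rw [div_le_iff₀ ht', ← div_eq_inv_mul, le_div_iff₀ hs0]
          exact hzs.trans htz
      _ = Real.exp (-(Real.log y / 2 * t)) := by
          rw [hsdef, ← Real.exp_neg, ← Real.exp_nat_mul]; congr 1; ring
      _ ≤ _ := by
          apply Real.exp_le_exp.2
          have : K * y ≤ t * Real.log y := (div_le_iff₀ hlog).1 htz
          linarith

/-- The number of grid slabs per axis used for `n` points in dimension `d`. -/
noncomputable def gridSize (d n : ℕ) : ℕ := ⌊((n : ℝ) / 8) ^ (2 / ((d : ℝ) + 1))⌋₊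

theorem gridSize_le {d n : ℕ} : (gridSize d n : ℝ) ≤ ((n : ℝ) / 8) ^ (2 / ((d : ℝ) + 1)) :=
  Nat.floor_le (by positivity)

theorem le_gridSize {d n : ℕ} (hn : 8 ≤ n) :
    0 < gridSize d n ∧ ((n : ℝ) / 8) ^ (2 / ((d : ℝ) + 1)) ≤ 2 * gridSize d n := by
  have h8 : (8 : ℝ) ≤ n := by exact_mod_cast hn
  have h1 : 1 ≤ ((n : ℝ) / 8) ^ (2 / ((d : ℝ) + 1)) :=
    Real.one_le_rpow (by linarith) (by positivity)
  have h2 : 0 < gridSize d n := Nat.floor_pos.2 h1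
  refine ⟨h2, ?_⟩
  have h3 := Nat.lt_floor_add_one (((n : ℝ) / 8) ^ (2 / ((d : ℝ) + 1)))
  have h4 : (1 : ℝ) ≤ gridSize d n := by exact_mod_cast h2
  unfold gridSize at *
  linarith

theorem gridSize_pow_le (d n : ℕ) : (gridSize d n : ℝ) ^ (d + 1) ≤ (n / 8 : ℝ) ^ 2 := by
  rw [← rpow_two_div_pow (by positivity) d]
  gcongr
  exact gridSize_le

theorem le_gridSize_pow (d : ℕ) {n : ℕ} (hn : 8 ≤ n) :
    (n / 8 : ℝ) ^ 2 ≤ 2 ^ (d + 1) * (gridSize d n : ℝ) ^ (d + 1) := by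
  rw [← rpow_two_div_pow (by positivity) d, ← mul_pow]
  gcongr
  exact (le_gridSize hn).2

theorem gridSize_le_div {d n : ℕ} (hd : 1 ≤ d) (hn : 8 ≤ n) : (gridSize d n : ℝ) ≤ n / 8 := by
  have h8 : (8 : ℝ) ≤ n := by exact_mod_cast hn
  have hd' : (1 : ℝ) ≤ d := by exact_mod_cast hd
  refine gridSize_le.trans ?_
  conv_rhs => rw [← Real.rpow_one ((n : ℝ) / 8)]
  apply Real.rpow_le_rpow_of_exponent_le (by linarith)
  rw [div_le_one (by positivity)]
  linarith

/-- The `8` in `gridSize` is small enough scaling to give `2 * N ≤ a` and `4 * N ^ (d + 1) ≤ a * b`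
for the two halves `a`, `b` of `n`. Each term is then at most `(1 / 4) ^ N`, which beats the `2 ^ N`
of the union bound. -/
theorem two_pow_gridSize_mul_le {d n : ℕ} (hd : 1 ≤ d) (hn : 8 ≤ n) :
    2 ^ gridSize d n * ((1 / 2) ^ (n / 2) +
      Real.exp (-((n / 2 : ℕ) * (n - n / 2 : ℕ) / (2 * (gridSize d n : ℝ) ^ d)))) ≤
      2 * (1 / 2 : ℝ) ^ gridSize d n := by
  have h8 : (8 : ℝ) ≤ n := by exact_mod_cast hn
  have hN := gridSize_le_div hd hn
  have hpow := gridSize_pow_le d n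
  have hN0 : (0 : ℝ) < gridSize d n := Nat.cast_pos.2 (le_gridSize hn).1
  set N := gridSize d n
  have ha : ((n : ℝ) - 1) / 2 ≤ (n / 2 : ℕ) := by
    have : n ≤ 2 * (n / 2) + 1 := by omega
    have : (n : ℝ) ≤ 2 * (n / 2 : ℕ) + 1 := by exact_mod_cast this
    linarith
  have hb : (n : ℝ) / 2 ≤ (n - n / 2 : ℕ) := by
    have : n ≤ 2 * (n - n / 2) := by omega
    have : (n : ℝ) ≤ 2 * (n - n / 2 : ℕ) := by exact_mod_cast this
    linarith
  set a := n / 2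
  set b := n - a
  have haN : 2 * N ≤ a := by
    have : 2 * (N : ℝ) ≤ a := by linarith
    exact_mod_cast this
  have hab : 4 * (N : ℝ) ^ (d + 1) ≤ a * b := by
    have : ((n : ℝ) - 1) / 2 * (n / 2) ≤ a * b := mul_le_mul ha hb (by positivity) (by positivity)
    nlinarith
  have h1 : (1 / 2 : ℝ) ^ a ≤ (1 / 4) ^ N := by
    calc (1 / 2 : ℝ) ^ a ≤ (1 / 2) ^ (2 * N) :=
          pow_le_pow_of_le_one (by norm_num) (by norm_num) haN
      _ = _ := by rw [pow_mul]; norm_num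
  have h2 : Real.exp (-(a * b / (2 * (N : ℝ) ^ d))) ≤ (1 / 4) ^ N := by
    have he : Real.exp (-2) ≤ 1 / 4 := by
      have h := Real.add_one_le_exp (1 : ℝ)
      rw [Real.exp_neg, inv_eq_one_div, show (2 : ℝ) = 1 + 1 by norm_num, Real.exp_add]
      apply one_div_le_one_div_of_le <;> nlinarith
    calc Real.exp (-(a * b / (2 * (N : ℝ) ^ d))) ≤ Real.exp (N * -2) := by
          apply Real.exp_le_exp.2
          have : (N : ℝ) * 2 ≤ a * b / (2 * (N : ℝ) ^ d) := by
            rw [le_div_iff₀ (by positivity)]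
            calc (N : ℝ) * 2 * (2 * N ^ d) = 4 * N ^ (d + 1) := by ring
              _ ≤ _ := hab
          linarith
      _ = Real.exp (-2) ^ N := Real.exp_nat_mul _ _
      _ ≤ _ := by gcongr
  calc _ ≤ 2 ^ N * ((1 / 4 : ℝ) ^ N + (1 / 4) ^ N) := by gcongr
    _ = 2 * (2 * (1 / 4) : ℝ) ^ N := by rw [mul_pow]; ring
    _ = _ := by norm_num

open Filter in
theorem eventually_half_pow_gridSize_le (d : ℕ) {γ : ℝ} (hγ : 0 < γ) :
    ∀ᶠ n : ℕ in atTop, 2 * (1 / 2 : ℝ) ^ gridSize d n ≤ 1 / 2 * (n : ℝ) ^ (-γ) := by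
  set p : ℝ := 2 / ((d : ℝ) + 1) with hp
  have hp0 : 0 < p := by positivity
  have hlog2 : 0 < Real.log 2 := Real.log_pos (by norm_num)
  have hc : 0 < Real.log 2 / (2 * 8 ^ p * (γ + 1)) := by positivity
  have h := tendsto_natCast_atTop_atTop.eventually ((isLittleO_log_rpow_atTop hp0).bound hc)
  filter_upwards [h, eventually_ge_atTop 8] with n h hn
  have h8 : (8 : ℝ) ≤ n := by exact_mod_cast hn
  have hn0 : (0 : ℝ) < n := by linarith
  have hl := Real.log_nonneg (show (1 : ℝ) ≤ n by linarith)
  rw [Real.norm_of_nonneg hl, Real.norm_of_nonneg (by positivity), div_mul_eq_mul_div,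
    le_div_iff₀ (by positivity)] at h
  have hN := (le_gridSize (d := d) hn).2
  rw [← hp, Real.div_rpow hn0.le (by norm_num), div_le_iff₀ (by positivity)] at hN
  have h4 : Real.log 4 ≤ Real.log n := Real.log_le_log (by norm_num) (by linarith)
  have key : Real.log 4 + γ * Real.log n ≤ gridSize d n * Real.log 2 := by
    have h8p : (0 : ℝ) < 2 * 8 ^ p := by positivity
    have : (Real.log n * (γ + 1)) * (2 * 8 ^ p) ≤ (gridSize d n * Real.log 2) * (2 * 8 ^ p) := by
      calc _ = Real.log n * (2 * 8 ^ p * (γ + 1)) := by ring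
        _ ≤ Real.log 2 * n ^ p := h
        _ ≤ Real.log 2 * (2 * gridSize d n * 8 ^ p) := by gcongr
        _ = _ := by ring
    have := le_of_mul_le_mul_right this h8p
    linarith
  have h1 : (1 / 2 : ℝ) ^ gridSize d n = Real.exp (-(gridSize d n * Real.log 2)) := by
    rw [Real.exp_neg, Real.exp_nat_mul, Real.exp_log (by norm_num)]; simp
  have h2 : (n : ℝ) ^ (-γ) = 4 * Real.exp (-(Real.log 4 + γ * Real.log n)) := by
    rw [neg_add, Real.exp_add, Real.exp_neg (Real.log 4), Real.exp_log (by norm_num),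
      Real.rpow_def_of_pos hn0]
    rw [show Real.log n * -γ = -(γ * Real.log n) by ring]
    ring
  rw [h1, h2]
  have := Real.exp_le_exp.2 (neg_le_neg key)
  linarith

open Filter in
theorem separability_lower_bound {d : ℕ} (hd : 1 ≤ d) {γ : ℝ} (hγ : 0 < γ) :
    ∃ c : ℝ, 0 < c ∧ ∃ n₀ : ℕ, ∀ n : ℕ, n₀ ≤ n →
      1 - (n : ℝ) ^ (-γ) ≤ (uniformPoints d n).real
        {x | ENNReal.ofReal (c * ((n : ℝ) ^ (2 / ((d : ℝ) + 1)) *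
          Real.log (Real.log n) / Real.log n)) ≤ sepNumber x} := by
  set p : ℝ := 2 / ((d : ℝ) + 1) with hp
  -- `K` makes one slab fail with probability at most `n ^ (-γ - 4)`, leaving room for the at most
  -- `n ^ 3 / 2` slabs. In `β`, which bounds `n ^ 2 * (4 * d + 3) / N ^ (d + 1)`, the `64` is `8 ^
  -- 2` and `2 ^ (d + 1)` pays for the floor in `gridSize`.
  set K : ℝ := 2 * (γ + 4) with hK
  set β : ℝ := 64 * 2 ^ (d + 1) * (4 * d + 3) with hβ
  have hK0 : 0 < K := by positivity
  refine ⟨1 / (64 * K * 8 ^ p), by positivity, ?_⟩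
  rw [← eventually_atTop]
  have hlog : Tendsto (fun n : ℕ => Real.log n) atTop atTop :=
    Real.tendsto_log_atTop.comp tendsto_natCast_atTop_atTop
  filter_upwards [eventually_ge_atTop 8, eventually_half_pow_gridSize_le d hγ,
    hlog.eventually (eventually_pow_div_factorial_le (β := β) (K := K) (by positivity) hK0),
    eventually_ge_atTop (2 * 3 ^ (d + 1) * d ^ 2)] with n hn hhalf ⟨hll, ht0, ht2, ht⟩ hn2
  have h8 : (8 : ℝ) ≤ n := by exact_mod_cast hn
  have hn0 : (0 : ℝ) < n := by linarith
  have hl : 0 < Real.log n := Real.log_pos (by linarith)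
  obtain ⟨hN0, hN⟩ := le_gridSize (d := d) hn
  have hbad := uniformPoints_sepNumber_lt_le hN0 hd (Nat.add_sub_of_le (Nat.div_le_self n 2)) ht0
  set t := ⌈K * Real.log n / Real.log (Real.log n)⌉₊
  have hNpow := gridSize_pow_le d n
  have hNpow' := le_gridSize_pow d hn
  have htwo := two_pow_gridSize_mul_le hd hn
  set N := gridSize d n
  have hN0' : (0 : ℝ) < N := Nat.cast_pos.2 hN0
  have ht0' : (0 : ℝ) < t := Nat.cast_pos.2 ht0
  have hratio : (n : ℝ) ^ 2 * (4 * d + 3) / (N : ℝ) ^ (d + 1) ≤ β := by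
    rw [div_le_iff₀ (by positivity), hβ]
    have : (n : ℝ) ^ 2 ≤ 64 * (2 ^ (d + 1) * (N : ℝ) ^ (d + 1)) := by linarith
    calc _ ≤ 64 * (2 ^ (d + 1) * (N : ℝ) ^ (d + 1)) * (4 * d + 3) := by gcongr
      _ = _ := by ring
  have hslab : 3 ^ (d + 1) * (d : ℝ) ^ 2 * (N : ℝ) ^ (d + 1) *
      (((n : ℝ) ^ 2 * (4 * d + 3) / (N : ℝ) ^ (d + 1)) ^ t / t.factorial) ≤
      1 / 2 * (n : ℝ) ^ (-γ) := by
    have hexp : Real.exp (-(K / 2 * Real.log n)) = (n : ℝ) ^ (-γ) / n ^ 4 := by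
      rw [show -(K / 2 * Real.log n) = Real.log n * (-γ - (4 : ℕ)) by rw [hK]; push_cast; ring,
        ← Real.rpow_def_of_pos hn0, Real.rpow_sub hn0, Real.rpow_natCast]
    have hn2' : 2 * 3 ^ (d + 1) * (d : ℝ) ^ 2 ≤ n := by exact_mod_cast hn2
    calc _ ≤ 3 ^ (d + 1) * (d : ℝ) ^ 2 * n ^ 2 * (β ^ t / t.factorial) := by
          gcongr
          refine hNpow.trans ?_
          nlinarith
      _ ≤ (n / 2) * n ^ 2 * ((n : ℝ) ^ (-γ) / n ^ 4) := by
          rw [← hexp]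
          gcongr
          linarith
      _ = 1 / 2 * (n : ℝ) ^ (-γ) * (1 / n) := by field_simp
      _ ≤ 1 / 2 * (n : ℝ) ^ (-γ) * 1 := by
          gcongr
          rw [div_le_one hn0]; linarith
      _ = _ := mul_one _
  have hbad' : (uniformPoints d n).real {x | sepNumber x < ENNReal.ofReal (N / (16 * t))} ≤
      (n : ℝ) ^ (-γ) := by
    refine ENNReal.toReal_le_of_le_ofReal (by positivity) (hbad.trans ?_)
    apply ENNReal.ofReal_le_ofReal
    linarith
  have hc : 1 / (64 * K * 8 ^ p) * ((n : ℝ) ^ p * Real.log (Real.log n) / Real.log n) ≤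
      N / (16 * t) := by
    rw [← hp, Real.div_rpow hn0.le (by norm_num), div_le_iff₀ (by positivity)] at hN
    calc 1 / (64 * K * 8 ^ p) * ((n : ℝ) ^ p * Real.log (Real.log n) / Real.log n)
        ≤ 1 / (64 * K * 8 ^ p) * ((2 * N * 8 ^ p) * Real.log (Real.log n) / Real.log n) := by
          gcongr
      _ = N / (16 * (2 * (K * Real.log n / Real.log (Real.log n)))) := by
          field_simp
          norm_num
      _ ≤ _ := by gcongr
  -- Covering the space by the good and bad events needs only subadditivity, not measurability.
  have huniv : (Set.univ : Set (Fin n → Fin d → ℝ)) ⊆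
      {x | ENNReal.ofReal (1 / (64 * K * 8 ^ p) * ((n : ℝ) ^ p *
          Real.log (Real.log n) / Real.log n)) ≤ sepNumber x} ∪
      {x | sepNumber x < ENNReal.ofReal (N / (16 * t))} := by
    intro x _
    rcases lt_or_ge (sepNumber x) (ENNReal.ofReal (N / (16 * t))) with h | h
    · exact Or.inr h
    · exact Or.inl ((ENNReal.ofReal_le_ofReal hc).trans h)
  have hone := (measureReal_mono (μ := uniformPoints d n) huniv).trans (measureReal_union_le _ _)
  rw [probReal_univ] at hone
  linarith

theorem mainTheorem3 :
    -- the separability of the random point set is a random variable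
    (∀ d n : ℕ, 1 ≤ d → AEMeasurable (sepNumber (d := d) (n := n)) (uniformPoints d n)) ∧
    -- lower bound, with high probability
    (∀ d : ℕ, 1 ≤ d → ∀ γ : ℝ, 0 < γ → ∃ c : ℝ, 0 < c ∧ ∃ n₀ : ℕ, ∀ n : ℕ, n₀ ≤ n →
      1 - (n : ℝ) ^ (-γ) ≤ (uniformPoints d n).real
        {x | ENNReal.ofReal (c * ((n : ℝ) ^ (2 / ((d : ℝ) + 1)) *
          Real.log (Real.log n) / Real.log n)) ≤ sepNumber x}) ∧
    -- upper bound, in expectation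
    (∃ C : ℝ, 0 < C ∧ ∀ d : ℕ, 1 ≤ d → ∀ n : ℕ,
      ∫⁻ x, sepNumber x ∂(uniformPoints d n) ≤
        ENNReal.ofReal (C * ((d : ℝ) * (n : ℝ) ^ (2 / ((d : ℝ) + 1))))) :=
  ⟨fun _ n hd => aemeasurable_sepNumber hd n, fun _ hd _ hγ => separability_lower_bound hd hγ,
    2, two_pos, fun _ hd n => lintegral_sepNumber_le hd n⟩
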